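/- For $D\ge 1$, $p>1$ and a bounded open convex set $\Omega\subset\mathbb R^D$, let $u_p\in W_0^{1,p}(\Omega)$ be the $p$-torsion function of $\Omega$, i.e. the unique weak solution of $-\operatorname{div}(|\nabla u|^{p-2}\nabla u)=1$ in $\Omega$, $u=0$ on $\partial\Omega$. Put \[ T_p(\Omega)=\int_\Omega u_p\,dx,\qquad T(p;\Omega)=|\Omega|^{p-1}\,T_p(\Omega)^{1-p},\qquad Q_p(\Omega)=\left(\frac{T(p;\Omega)\,R_\Omega^{\,p}}{\left(\frac{2p-1}{p-1}\right)^{p-1}}\right)^{1/p}, \] where $|\Omega|$ is the Lebesgue measure and $R_\Omega$ is the inradius of $\Omega$ (the supremum of the radii of balls contained in $\Omega$). For a family $\mathcal F$ of such sets put $\gamma_{\mathcal F}(p)=\inf_{\Omega\in\mathcal F}Q_p(\Omega)\big/\sup_{\Omega\in\mathcal F}Q_p(\Omega)$. For $\kappa\ge 2$ let \[ \mathcal R_\kappa=\{(0,L)\times(0,2R)\subset\mathbb R^2 : R>0,\ L>0,\ L/R\ge\kappa\}. \] Proposition. Let $p>1$ and $\kappa\ge2$ be real numbers. Then $1\le Q_p(\Omega)<1+\frac2\kappa$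 for every $\Omega\in\mathcal R_\kappa$, and \[ \gamma_{\mathcal R_\kappa}(p)\ \ge\ \frac{\kappa}{\kappa+2}. \] -/

import Mathlib

open scoped ContDiff

noncomputable section

namespace PTorsion

open MeasureTheory Filter Topology

/-- `D`-dimensional Euclidean space. -/
abbrev E (D : ℕ) : Type := EuclideanSpace ℝ (Fin D)

/-- `φ ∈ C_c^∞(Ω)`. -/
def IsTestFunction {D : ℕ} (Ω : Set (E D)) (φ : E D → ℝ) : Prop :=
  ContDiff ℝ ∞ φ ∧ HasCompactSupport φ ∧ tsupport φ ⊆ Ω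

/-- `G` is the weak (distributional) gradient of `u` on `Ω`:
`∫_Ω u ∇φ = - ∫_Ω φ G` for all `φ ∈ C_c^∞(Ω)`. -/
def IsWeakGradient {D : ℕ} (Ω : Set (E D)) (u : E D → ℝ) (G : E D → E D) : Prop :=
  ∀ φ : E D → ℝ, IsTestFunction Ω φ →
    ∫ x in Ω, u x • gradient φ x = - ∫ x in Ω, φ x • G x

/-- `u ∈ W^{1,p}(Ω)` with weak gradient `G`. Only the values on `Ω` matter. -/
def MemW {D : ℕ} (p : ℝ) (Ω : Set (E D)) (u : E D → ℝ) (G : E D → E D) : Prop :=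
  MemLp u (ENNReal.ofReal p) (volume.restrict Ω) ∧
  MemLp G (ENNReal.ofReal p) (volume.restrict Ω) ∧
  IsWeakGradient Ω u G

/-- `u ∈ W_0^{1,p}(Ω)` with weak gradient `G`: `u` is in the closure of `C_c^∞(Ω)`
in the norm of `W^{1,p}(Ω)`. -/
def MemWZero {D : ℕ} (p : ℝ) (Ω : Set (E D)) (u : E D → ℝ) (G : E D → E D) : Prop :=
  MemW p Ω u G ∧
  ∃ φ : ℕ → E D → ℝ, (∀ n, IsTestFunction Ω (φ n)) ∧
    Tendsto (fun n => eLpNorm (fun x => φ n x - u x) (ENNReal.ofReal p) (volume.restrict Ω))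
      atTop (𝓝 0) ∧
    Tendsto (fun n => eLpNorm (fun x => gradient (φ n) x - G x) (ENNReal.ofReal p)
      (volume.restrict Ω)) atTop (𝓝 0)

/-- `u` is a `p`-torsion function on `Ω`: a weak solution `u ∈ W_0^{1,p}(Ω)` of `-Δ_p u = 1` in
`Ω`, `u = 0` on `∂Ω`, that is
`∫_Ω |∇u|^{p-2} ⟨∇u, ∇v⟩ = ∫_Ω v` for all `v ∈ W_0^{1,p}(Ω)`. -/
def IsTorsionFunction {D : ℕ} (p : ℝ) (Ω : Set (E D)) (u : E D → ℝ) : Prop :=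
  ∃ G : E D → E D, MemWZero p Ω u G ∧
    ∀ (v : E D → ℝ) (H : E D → E D), MemWZero p Ω v H →
      ∫ x in Ω, ‖G x‖ ^ (p - 2) * inner ℝ (G x) (H x) = ∫ x in Ω, v x

open Classical in
/-- The `p`-torsion function `u_p` of `Ω` (unique up to null sets for `1 < p` and bounded open
`Ω`; the value `0` is used only if there is no weak solution). -/
def torsionFunction {D : ℕ} (p : ℝ) (Ω : Set (E D)) : E D → ℝ :=
  if h : ∃ u : E D → ℝ, IsTorsionFunction p Ω u then h.choose else 0

/-- The `p`-torsional rigidity `T_p(Ω) = ∫_Ω u_p`. -/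
def torsionalRigidity {D : ℕ} (p : ℝ) (Ω : Set (E D)) : ℝ :=
  ∫ x in Ω, torsionFunction p Ω x

/-- The normalized `p`-torsional rigidity `T(p;Ω) = |Ω|^{p-1} T_p(Ω)^{1-p}`. -/
def normalizedRigidity {D : ℕ} (p : ℝ) (Ω : Set (E D)) : ℝ :=
  (volume Ω).toReal ^ (p - 1) * torsionalRigidity p Ω ^ (1 - p)

/-- The inradius: the supremum of the radii of balls contained in `Ω`. -/
def inradius {D : ℕ} (Ω : Set (E D)) : ℝ :=
  sSup {r : ℝ | 0 ≤ r ∧ ∃ x : E D, Metric.ball x r ⊆ Ω}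

/-- The scale-invariant quantity `Q_p(Ω)`. -/
def Q {D : ℕ} (p : ℝ) (Ω : Set (E D)) : ℝ :=
  (normalizedRigidity p Ω * inradius Ω ^ p / ((2 * p - 1) / (p - 1)) ^ (p - 1)) ^ (1 / p)

/-- `α_F(p) = inf_{Ω ∈ F} Q_p(Ω)`. -/
def familyInf {D : ℕ} (F : Set (Set (E D))) (p : ℝ) : ℝ := sInf (Q p '' F)

/-- `β_F(p) = sup_{Ω ∈ F} Q_p(Ω)`. -/
def familySup {D : ℕ} (F : Set (Set (E D))) (p : ℝ) : ℝ := sSup (Q p '' F)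

/-- `γ_F(p) = α_F(p) / β_F(p)`. -/
def familyRatio {D : ℕ} (F : Set (Set (E D))) (p : ℝ) : ℝ := familyInf F p / familySup F p

/-- The open planar rectangle `(0,L) × (0,2R)`. -/
def rectangle (R L : ℝ) : Set (E 2) :=
  {x | x 0 ∈ Set.Ioo 0 L ∧ x 1 ∈ Set.Ioo 0 (2 * R)}

/-- The family of rectangles `(0,L) × (0,2R)` with `L / R ≥ κ`. -/
def rectangleFamily (κ : ℝ) : Set (Set (E 2)) :=
  {Ω | ∃ R L : ℝ, 0 < R ∧ 0 < L ∧ κ ≤ L / R ∧ Ω = rectangle R L}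

end PTorsion

end

/-!
Let `q` be the conjugate exponent of `p`, let `u` be the torsion function of a domain `Ω` and put
`T = ∫ u`, so that `T = ∫ |∇u|^p`. The field `x ↦ (y - R) e`, where `y` is the second coordinate and
`e` the second basis vector, has divergence `1`, so integration by parts and Hölder's inequality
give `T ≤ ‖y - R‖_q T^{1/p}`, that is `T ≤ ∫ |y - R|^q`. On the rectangle the right-hand side is the
torsion of the infinite strip restricted to length `L`, and `T` lying below it means `Q_p ≥ 1`.

In the other direction, let `δ` be the distance to the boundary and let `w(t) = (R^q - (R - t)^q)/q`
be the profile of the torsion function of the strip. Since `|∇(w ∘ δ)| = (R - δ)^{q-1}`, testing the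
equation with `w ∘ δ` gives `∫ w(δ) ≤ T^{1/q} (∫ (R - δ)^q)^{1/p}`. Both integrals are explicit for
the rectangle by the layer-cake formula, and `∫ (R - δ)^q ≤ (1 + 2R/L) ∫ w(δ)`. To stay within
`C_c^∞` one mollifies `w ∘ max (δ - ε) 0` instead, which keeps the gradient bound up to an error
vanishing with `ε`.

The torsion function is a minimizer of `‖∇v‖_p^p / p - ∫ v` on `W_0^{1,p}`. It is a multiple of the
minimizer of `‖∇v‖_p` under the constraint `∫ v = 1`, that is of an element of least norm in a
convex set of gradients. This set is complete by Poincaré's inequality, so the element exists by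
uniform convexity of `L^p`.
-/

open scoped ContDiff

namespace PTorsion

open MeasureTheory Filter Topology

/-! ### Gradients and integration by parts -/

section Gradient

variable {F : Type*} [NormedAddCommGroup F] [InnerProductSpace ℝ F] [CompleteSpace F]
  {φ ψ : F → ℝ} {x : F}

theorem norm_gradient (φ : F → ℝ) (x : F) : ‖gradient φ x‖ = ‖fderiv ℝ φ x‖ :=
  LinearIsometryEquiv.norm_map _ _

theorem continuous_gradient (h : ContDiff ℝ 1 φ) : Continuous (gradient φ) :=
  (LinearIsometryEquiv.continuous _).comp (h.continuous_fderiv one_ne_zero)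

theorem gradient_of_notMem_tsupport (hx : x ∉ tsupport φ) : gradient φ x = 0 := by
  rw [gradient, fderiv_of_notMem_tsupport ℝ hx, map_zero]

theorem hasCompactSupport_gradient (h : HasCompactSupport φ) : HasCompactSupport (gradient φ) :=
  (h.fderiv (𝕜 := ℝ)).comp_left (map_zero _)

theorem gradient_add (hφ : DifferentiableAt ℝ φ x) (hψ : DifferentiableAt ℝ ψ x) :
    gradient (φ + ψ) x = gradient φ x + gradient ψ x := by
  rw [gradient, fderiv_add hφ hψ, map_add, gradient, gradient]

theorem gradient_const_smul (c : ℝ) (hφ : DifferentiableAt ℝ φ x) :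
    gradient (c • φ) x = c • gradient φ x := by
  rw [gradient, fderiv_const_smul hφ, map_smulₛₗ, conj_trivial, gradient]

end Gradient

section IntegrationByParts

theorem integral_smul_gradient {F : Type*} [NormedAddCommGroup F] [InnerProductSpace ℝ F]
    [FiniteDimensional ℝ F] [MeasurableSpace F] [BorelSpace F] {μ : Measure F}
    [μ.IsAddHaarMeasure] {φ h : F → ℝ} (hφ : ContDiff ℝ 1 φ) (hc : HasCompactSupport φ)
    (hh : ContDiff ℝ 1 h) : ∫ x, φ x • gradient h x ∂μ = - ∫ x, h x • gradient φ x ∂μ := by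
  have cφ := hφ.continuous
  have ch := hh.continuous
  have intφ : Integrable (fun x => φ x • gradient h x) μ :=
    (cφ.smul (continuous_gradient hh)).integrable_of_hasCompactSupport hc.smul_right
  have inth : Integrable (fun x => h x • gradient φ x) μ :=
    (ch.smul (continuous_gradient hφ)).integrable_of_hasCompactSupport
      (hasCompactSupport_gradient hc).smul_left
  refine ext_inner_left ℝ fun e => ?_
  rw [inner_neg_right, ← integral_inner intφ, ← integral_inner inth]
  simp only [inner_smul_right, inner_gradient_right, conj_trivial]
  refine (integral_mul_fderiv_eq_neg_fderiv_mul_of_integrable (v := e) ?_ ?_ ?_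
    (fun x _ => hφ.differentiable one_ne_zero x)
    (fun x _ => hh.differentiable one_ne_zero x)).trans (by simp only [mul_comm])
  · exact (((hφ.continuous_fderiv one_ne_zero).clm_apply continuous_const).mul
      ch).integrable_of_hasCompactSupport
        ((hc.fderiv (𝕜 := ℝ)).comp_left (g := fun L : F →L[ℝ] ℝ => L e) rfl).mul_right
  · exact (cφ.mul ((hh.continuous_fderiv one_ne_zero).clm_apply
      continuous_const)).integrable_of_hasCompactSupport hc.mul_right
  · exact (cφ.mul ch).integrable_of_hasCompactSupport hc.mul_right

variable {D : ℕ}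

theorem contDiff_coord_sub (i : Fin D) (c : ℝ) {n : WithTop ℕ∞} :
    ContDiff ℝ n (fun x : E D => x i - c) :=
  (EuclideanSpace.proj (𝕜 := ℝ) i : E D →L[ℝ] ℝ).contDiff.sub contDiff_const

theorem gradient_coord_sub (i : Fin D) (c : ℝ) (x : E D) :
    gradient (fun y : E D => y i - c) x = EuclideanSpace.single i 1 := by
  refine HasGradientAt.gradient (hasGradientAt_iff_hasFDerivAt.2 ?_)
  refine ((EuclideanSpace.proj (𝕜 := ℝ) i : E D →L[ℝ] ℝ).hasFDerivAt.sub_const c).congr_fderiv ?_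
  ext y
  simp [EuclideanSpace.inner_single_left]

theorem integral_eq_neg_integral_coord_mul_gradient {g : E D → ℝ} (hg : ContDiff ℝ 1 g)
    (hc : HasCompactSupport g) (i : Fin D) (c : ℝ) :
    ∫ x, g x = - ∫ x, (x i - c) * gradient g x i := by
  have h := integral_smul_gradient hg hc (contDiff_coord_sub i c) (μ := volume)
  simp only [gradient_coord_sub] at h
  have int : Integrable (fun x : E D => (x i - c) • gradient g x) :=
    ((contDiff_coord_sub i c (n := 0)).continuous.smul
      (continuous_gradient hg)).integrable_of_hasCompactSupport
      (hasCompactSupport_gradient hc).smul_left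
  have h' := congrArg (inner ℝ (EuclideanSpace.single i (1 : ℝ))) h
  rw [inner_neg_right, ← integral_inner int, ← integral_inner
    ((hg.continuous.integrable_of_hasCompactSupport hc).smul_const _)] at h'
  simpa [inner_smul_right, EuclideanSpace.inner_single_left, -inner_gradient_right] using h'

end IntegrationByParts

section Pairing

variable {α F G H : Type*} [MeasurableSpace α] {μ : Measure α} [NormedAddCommGroup F]
  [NormedSpace ℝ F] [NormedAddCommGroup G] [NormedSpace ℝ G] [NormedAddCommGroup H]
  [NormedSpace ℝ H] [CompleteSpace H]

theorem tendsto_integral_bilin_of_tendsto_eLpNorm {r s : ENNReal} [Fact (1 ≤ r)] [Fact (1 ≤ s)]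
    [ENNReal.HolderConjugate r s] (B : F →L[ℝ] G →L[ℝ] H) {f : ℕ → α → F} {f' : α → F} {g : α → G}
    (hf : ∀ n, MemLp (f n) r μ) (hf' : MemLp f' r μ) (hg : MemLp g s μ)
    (h : Tendsto (fun n => eLpNorm (fun x => f n x - f' x) r μ) atTop (𝓝 0)) :
    Tendsto (fun n => ∫ x, B (f n x) (g x) ∂μ) atTop (𝓝 (∫ x, B (f' x) (g x) ∂μ)) := by
  have eq_lpPairing : ∀ {f : α → F} (hf : MemLp f r μ),
      B.lpPairing μ r s (hf.toLp f) (hg.toLp g) = ∫ x, B (f x) (g x) ∂μ := fun hf => by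
    rw [ContinuousLinearMap.lpPairing_eq_integral]
    refine integral_congr_ae ?_
    filter_upwards [hf.coeFn_toLp, hg.coeFn_toLp] with x hx hx'
    rw [hx, hx']
  have hlim := (Lp.tendsto_Lp_iff_tendsto_eLpNorm'' f hf f' hf').2 h
  simpa only [ContinuousLinearMap.flip_apply, eq_lpPairing, Function.comp_def] using
    (((B.lpPairing μ r s).flip (hg.toLp g)).continuous.tendsto _).comp hlim

end Pairing

/-! ### Test functions and `W_0^{1,p}` -/

section Sobolev

variable {D : ℕ} {p q : ℝ} {Ω : Set (E D)} {φ ψ : E D → ℝ}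

namespace IsTestFunction

theorem contDiff_one (h : IsTestFunction Ω φ) : ContDiff ℝ 1 φ :=
  h.1.of_le (mod_cast le_top)

theorem differentiable (h : IsTestFunction Ω φ) : Differentiable ℝ φ :=
  h.contDiff_one.differentiable one_ne_zero

theorem memLp (h : IsTestFunction Ω φ) (r : ENNReal) : MemLp φ r (volume.restrict Ω) :=
  (h.1.continuous.memLp_of_hasCompactSupport h.2.1).restrict Ω

theorem memLp_gradient (h : IsTestFunction Ω φ) (r : ENNReal) :
    MemLp (gradient φ) r (volume.restrict Ω) :=
  ((continuous_gradient h.contDiff_one).memLp_of_hasCompactSupport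
    (hasCompactSupport_gradient h.2.1)).restrict Ω

theorem setIntegral_eq {F : Type*} [NormedAddCommGroup F] [NormedSpace ℝ F]
    (h : IsTestFunction Ω φ) {f : E D → F} (hf : ∀ x, x ∉ tsupport φ → f x = 0) :
    ∫ x in Ω, f x = ∫ x, f x :=
  setIntegral_eq_integral_of_forall_compl_eq_zero fun x hx => hf x fun hx' => hx (h.2.2 hx')

theorem setIntegral_smul_gradient {h : E D → ℝ} (hφ : IsTestFunction Ω φ) (hh : ContDiff ℝ 1 h) :
    ∫ x in Ω, φ x • gradient h x = - ∫ x in Ω, h x • gradient φ x := by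
  rw [hφ.setIntegral_eq, hφ.setIntegral_eq, integral_smul_gradient hφ.contDiff_one hφ.2.1 hh]
  · exact fun x hx => by rw [gradient_of_notMem_tsupport hx, smul_zero]
  · exact fun x hx => by rw [image_eq_zero_of_notMem_tsupport hx, zero_smul]

theorem zero : IsTestFunction Ω (0 : E D → ℝ) :=
  ⟨contDiff_const, HasCompactSupport.zero, by simp [tsupport]⟩

theorem add (hφ : IsTestFunction Ω φ) (hψ : IsTestFunction Ω ψ) : IsTestFunction Ω (φ + ψ) :=
  ⟨hφ.1.add hψ.1, hφ.2.1.add hψ.2.1, (tsupport_add φ ψ).trans (Set.union_subset hφ.2.2 hψ.2.2)⟩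

theorem smul (c : ℝ) (hφ : IsTestFunction Ω φ) : IsTestFunction Ω (c • φ) :=
  ⟨contDiff_const.smul hφ.1, hφ.2.1.smul_left (f := fun _ => c),
    (tsupport_smul_subset_right (fun _ => c) φ).trans hφ.2.2⟩

end IsTestFunction

theorem setIntegral_smul_gradient_of_tendsto (hpq : p.HolderConjugate q) {φ : ℕ → E D → ℝ}
    {u : E D → ℝ} {G : E D → E D} (hφ : ∀ n, IsTestFunction Ω (φ n))
    (hu : MemLp u (ENNReal.ofReal p) (volume.restrict Ω))
    (hG : MemLp G (ENNReal.ofReal p) (volume.restrict Ω))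
    (hφu : Tendsto (fun n => eLpNorm (fun x => φ n x - u x) (ENNReal.ofReal p)
      (volume.restrict Ω)) atTop (𝓝 0))
    (hφG : Tendsto (fun n => eLpNorm (fun x => gradient (φ n) x - G x) (ENNReal.ofReal p)
      (volume.restrict Ω)) atTop (𝓝 0))
    {h : E D → ℝ} (hh : ContDiff ℝ 1 h)
    (hhq : MemLp h (ENNReal.ofReal q) (volume.restrict Ω))
    (hhq' : MemLp (gradient h) (ENNReal.ofReal q) (volume.restrict Ω)) :
    ∫ x in Ω, u x • gradient h x = - ∫ x in Ω, h x • G x := by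
  have := hpq.ennrealOfReal
  have : Fact (1 ≤ ENNReal.ofReal p) := ⟨ENNReal.one_le_ofReal.2 hpq.lt.le⟩
  have : Fact (1 ≤ ENNReal.ofReal q) := ⟨ENNReal.one_le_ofReal.2 hpq.symm.lt.le⟩
  have lim_smul := tendsto_integral_bilin_of_tendsto_eLpNorm (ContinuousLinearMap.lsmul ℝ ℝ)
    (fun n => (hφ n).memLp _) hu hhq' hφu
  have lim_smul_flip := tendsto_integral_bilin_of_tendsto_eLpNorm
    (ContinuousLinearMap.lsmul ℝ ℝ).flip (fun n => (hφ n).memLp_gradient _) hG hhq hφG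
  exact tendsto_nhds_unique lim_smul
    (lim_smul_flip.neg.congr fun n => ((hφ n).setIntegral_smul_gradient hh).symm)

theorem memWZero_of_tendsto (hpq : p.HolderConjugate q) {φ : ℕ → E D → ℝ}
    {u : E D → ℝ} {G : E D → E D} (hφ : ∀ n, IsTestFunction Ω (φ n))
    (hu : MemLp u (ENNReal.ofReal p) (volume.restrict Ω))
    (hG : MemLp G (ENNReal.ofReal p) (volume.restrict Ω))
    (hφu : Tendsto (fun n => eLpNorm (fun x => φ n x - u x) (ENNReal.ofReal p)
      (volume.restrict Ω)) atTop (𝓝 0))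
    (hφG : Tendsto (fun n => eLpNorm (fun x => gradient (φ n) x - G x) (ENNReal.ofReal p)
      (volume.restrict Ω)) atTop (𝓝 0)) :
    MemWZero p Ω u G :=
  ⟨⟨hu, hG, fun _ hψ => setIntegral_smul_gradient_of_tendsto hpq hφ hu hG hφu hφG
    hψ.contDiff_one (hψ.memLp _) (hψ.memLp_gradient _)⟩, φ, hφ, hφu, hφG⟩

theorem IsTestFunction.memWZero (h : IsTestFunction Ω φ) : MemWZero p Ω φ (gradient φ) := by
  refine ⟨⟨h.memLp _, h.memLp_gradient _, fun ψ hψ => ?_⟩, fun _ => φ, fun _ => h, ?_, ?_⟩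
  · exact h.setIntegral_smul_gradient hψ.contDiff_one
  · simp
  · simp

theorem MemWZero.setIntegral_eq_neg_setIntegral_coord_mul [IsFiniteMeasure (volume.restrict Ω)]
    (hpq : p.HolderConjugate q) {u : E D → ℝ} {G : E D → E D} (hu : MemWZero p Ω u G) {i : Fin D}
    {c ρ : ℝ} (hΩ : ∀ᵐ x ∂volume.restrict Ω, |x i - c| ≤ ρ) :
    ∫ x in Ω, u x = - ∫ x in Ω, (x i - c) * G x i := by
  obtain ⟨⟨hup, hGp, -⟩, φ, hφ, hφu, hφG⟩ := hu
  have hp1 : 1 ≤ ENNReal.ofReal p := ENNReal.one_le_ofReal.2 hpq.lt.le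
  have hcoord := contDiff_coord_sub i c (n := 1)
  have hcoord_memLp : ∀ r, MemLp (fun x : E D => x i - c) r (volume.restrict Ω) := fun r =>
    .of_bound hcoord.continuous.aestronglyMeasurable ρ hΩ
  have h := setIntegral_smul_gradient_of_tendsto hpq hφ hup hGp hφu hφG hcoord (hcoord_memLp _)
    (by simpa only [funext (gradient_coord_sub i c)] using memLp_const _)
  simp only [gradient_coord_sub] at h
  have int : Integrable (fun x : E D => (x i - c) • G x) (volume.restrict Ω) := by
    have := hpq.ennrealOfReal
    exact memLp_one_iff_integrable.1 (hGp.smul (hcoord_memLp (ENNReal.ofReal q)))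
  have h' := congrArg (inner ℝ (EuclideanSpace.single i (1 : ℝ))) h
  rw [inner_neg_right, ← integral_inner int, ← integral_inner
    ((hup.integrable hp1).smul_const _)] at h'
  simpa [inner_smul_right, EuclideanSpace.inner_single_left] using h'

end Sobolev

/-! ### Poincaré's inequality in a slab -/

section Poincare

variable {D : ℕ} {p q : ℝ}

theorem le_rpow_mul_of_le_mul_rpow_mul_rpow (hpq : p.HolderConjugate q) {A B C : ℝ} (hA : 0 ≤ A)
    (hB : 0 ≤ B) (hC : 0 ≤ C) (h : A ≤ C * (A ^ (1 / q) * B ^ (1 / p))) : A ≤ C ^ p * B := by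
  rcases hA.eq_or_lt with rfl | hA
  · positivity
  have hsplit : A ^ (1 / q) * A ^ (1 / p) = A := by
    rw [← Real.rpow_add hA, one_div, one_div, hpq.symm.inv_add_inv_eq_one, Real.rpow_one]
  have hroot : A ^ (1 / p) ≤ C * B ^ (1 / p) :=
    le_of_mul_le_mul_left (by linarith) (Real.rpow_pos_of_pos hA (1 / q))
  calc A = (A ^ (1 / p)) ^ p := by rw [← Real.rpow_mul hA.le, one_div_mul_cancel hpq.ne_zero,
        Real.rpow_one]
    _ ≤ (C * B ^ (1 / p)) ^ p := Real.rpow_le_rpow (by positivity) hroot hpq.nonneg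
    _ = C ^ p * B := by rw [Real.mul_rpow hC (by positivity), ← Real.rpow_mul hB,
        one_div_mul_cancel hpq.ne_zero, Real.rpow_one]

theorem integral_norm_rpow_le_integral_mul_norm_gradient {φ : E D → ℝ} (hp : 1 < p)
    (hφ : ContDiff ℝ 1 φ) (hc : HasCompactSupport φ) {i : Fin D} {c ρ : ℝ}
    (hρ : ∀ x ∈ tsupport φ, |x i - c| ≤ ρ) :
    ∫ x, ‖φ x‖ ^ p ≤ ρ * p * ∫ x, ‖φ x‖ ^ (p - 1) * ‖gradient φ x‖ := by
  have hp0 : p ≠ 0 := by linarith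
  have hsupp : tsupport (fun x => ‖φ x‖ ^ p) ⊆ tsupport φ := closure_mono fun x hx hx' =>
    Function.mem_support.1 hx (by rw [hx', norm_zero, Real.zero_rpow hp0])
  have int : Integrable fun x => ‖φ x‖ ^ (p - 1) * ‖gradient φ x‖ :=
    ((hφ.continuous.norm.rpow_const fun _ => Or.inr (by linarith)).mul
      (continuous_gradient hφ).norm).integrable_of_hasCompactSupport
      (hasCompactSupport_gradient hc).norm.mul_left
  rw [integral_eq_neg_integral_coord_mul_gradient (g := fun x => ‖φ x‖ ^ p)
    ((contDiff_norm_rpow hp).comp hφ)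
    (HasCompactSupport.of_support_subset_isCompact hc (subset_closure.trans hsupp)) i c,
    ← integral_neg, ← integral_const_mul]
  refine (Real.le_norm_self _).trans (norm_integral_le_of_norm_le (int.const_mul _) (.of_forall ?_))
  intro x
  by_cases hx : x ∈ tsupport φ
  · rw [norm_neg, norm_mul, mul_assoc]
    refine mul_le_mul (hρ x hx) ?_ (norm_nonneg _) ((abs_nonneg _).trans (hρ x hx))
    refine (PiLp.norm_apply_le _ i).trans ?_
    rw [norm_gradient, norm_gradient, ← mul_assoc]
    exact norm_fderiv_norm_rpow_le (hφ.differentiable one_ne_zero) hp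
  · rw [gradient_of_notMem_tsupport (fun h => hx (hsupp h)), gradient_of_notMem_tsupport hx]
    simp

theorem poincare_of_tsupport_subset_slab (hpq : p.HolderConjugate q) {φ : E D → ℝ}
    (hφ : ContDiff ℝ 1 φ) (hc : HasCompactSupport φ) {i : Fin D} {c ρ : ℝ} (hρ0 : 0 ≤ ρ)
    (hρ : ∀ x ∈ tsupport φ, |x i - c| ≤ ρ) :
    ∫ x, ‖φ x‖ ^ p ≤ (ρ * p) ^ p * ∫ x, ‖gradient φ x‖ ^ p := by
  have memLp_φ : MemLp (fun x => ‖φ x‖ ^ (p - 1)) (ENNReal.ofReal q) := by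
    refine Continuous.memLp_of_hasCompactSupport ?_ ?_
    · exact hφ.continuous.norm.rpow_const fun _ => Or.inr hpq.sub_one_pos.le
    · exact hc.comp_left (g := fun y : ℝ => ‖y‖ ^ (p - 1))
        (by rw [norm_zero, Real.zero_rpow hpq.sub_one_ne_zero])
  have memLp_gradient : MemLp (fun x => ‖gradient φ x‖) (ENNReal.ofReal p) :=
    ((continuous_gradient hφ).memLp_of_hasCompactSupport (hasCompactSupport_gradient hc)).norm
  have holder := integral_mul_le_Lp_mul_Lq_of_nonneg hpq.symm
    (.of_forall fun x => by positivity) (.of_forall fun x => by positivity) memLp_φ memLp_gradient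
  simp only [← Real.rpow_mul (norm_nonneg _), hpq.sub_one_mul_conj] at holder
  have := hpq.pos
  refine le_rpow_mul_of_le_mul_rpow_mul_rpow hpq (integral_nonneg fun x => by positivity)
    (integral_nonneg fun x => by positivity) (by positivity) ?_
  exact (integral_norm_rpow_le_integral_mul_norm_gradient hpq.lt hφ hc hρ).trans (by gcongr)

end Poincare

/-! ### Uniform convexity of `L^p` -/

section NormRpow

variable {F : Type*} [NormedAddCommGroup F] [NormedSpace ℝ F] {p : ℝ}

theorem norm_inv_two_smul_add (a b : F) : ‖(2⁻¹ : ℝ) • (a + b)‖ = ‖a + b‖ / 2 := by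
  rw [norm_smul, norm_inv, Real.norm_two, inv_mul_eq_div]

theorem half_add_rpow_le {s t : ℝ} (hp : 1 ≤ p) (hs : 0 ≤ s) (ht : 0 ≤ t) :
    ((s + t) / 2) ^ p ≤ (s ^ p + t ^ p) / 2 := by
  have h := (convexOn_rpow hp).right hs ht (by norm_num : (0 : ℝ) ≤ 1 / 2)
    (by norm_num : (0 : ℝ) ≤ 1 / 2) (by norm_num)
  simp only [smul_eq_mul] at h
  rw [show (s + t) / 2 = 1 / 2 * s + 1 / 2 * t by ring]
  linarith

theorem half_add_rpow_lt {s t : ℝ} (hp : 1 < p) (hs : 0 ≤ s) (ht : 0 ≤ t) (hst : s ≠ t) :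
    ((s + t) / 2) ^ p < (s ^ p + t ^ p) / 2 := by
  have h := (strictConvexOn_rpow hp).2 hs ht hst (by norm_num : (0 : ℝ) < 1 / 2)
    (by norm_num : (0 : ℝ) < 1 / 2) (by norm_num)
  simp only [smul_eq_mul] at h
  rw [show (s + t) / 2 = 1 / 2 * s + 1 / 2 * t by ring]
  linarith

theorem norm_midpoint_rpow_le (hp : 1 ≤ p) (a b : F) :
    ‖(2⁻¹ : ℝ) • (a + b)‖ ^ p ≤ (‖a‖ ^ p + ‖b‖ ^ p) / 2 := by
  rw [norm_inv_two_smul_add]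
  refine le_trans ?_ (half_add_rpow_le hp (norm_nonneg a) (norm_nonneg b))
  gcongr
  exact norm_add_le a b

theorem norm_midpoint_rpow_lt [StrictConvexSpace ℝ F] (hp : 1 < p) {a b : F} (hab : a ≠ b) :
    ‖(2⁻¹ : ℝ) • (a + b)‖ ^ p < (‖a‖ ^ p + ‖b‖ ^ p) / 2 := by
  by_cases hn : ‖a‖ = ‖b‖
  · rw [← hn, add_self_div_two, ← one_div]
    exact Real.rpow_lt_rpow (norm_nonneg _) ((norm_midpoint_lt_iff hn).2 hab) (by linarith)
  · rw [norm_inv_two_smul_add]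
    refine lt_of_le_of_lt ?_ (half_add_rpow_lt hp (norm_nonneg a) (norm_nonneg b) hn)
    gcongr
    exact norm_add_le a b

theorem norm_sub_rpow_le (hp : 1 ≤ p) (a b : F) :
    ‖a - b‖ ^ p ≤ 2 ^ p * (‖a‖ ^ p + ‖b‖ ^ p) := by
  have h := norm_midpoint_rpow_le hp a (-b)
  rw [norm_inv_two_smul_add, norm_neg, ← sub_eq_add_neg, Real.div_rpow (norm_nonneg _) zero_le_two,
    div_le_iff₀' (by positivity)] at h
  exact h.trans (by gcongr; exact half_le_self (by positivity))

theorem exists_pos_forall_le_midpoint_gap [FiniteDimensional ℝ F] [StrictConvexSpace ℝ F]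
    (hp : 1 < p) {ε : ℝ} (hε : 0 < ε) :
    ∃ δ > 0, ∀ a b : F, ‖a‖ ^ p + ‖b‖ ^ p = 1 → ε ≤ ‖a - b‖ ^ p →
      δ ≤ (‖a‖ ^ p + ‖b‖ ^ p) / 2 - ‖(2⁻¹ : ℝ) • (a + b)‖ ^ p := by
  have hp0 : 0 < p := by linarith
  have hcont : Continuous fun x : F => ‖x‖ ^ p := continuous_norm.rpow_const fun _ => Or.inr hp0.le
  have cont_fst := hcont.comp (continuous_fst (X := F) (Y := F))
  have cont_snd := hcont.comp (continuous_snd (X := F) (Y := F))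
  have cont_sub := hcont.comp (continuous_fst.sub (continuous_snd (X := F)))
  have cont_mid := hcont.comp ((continuous_fst.add (continuous_snd (X := F))).const_smul (2⁻¹ : ℝ))
  have norm_le_one : ∀ {s t : ℝ}, 0 ≤ s → 0 ≤ t → s ^ p + t ^ p = 1 → s ≤ 1 := fun hs ht h =>
    (Real.rpow_le_rpow_iff hs zero_le_one hp0).1 <| by
      rw [Real.one_rpow]
      linarith [Real.rpow_nonneg ht p]
  have hK : IsCompact {x : F × F | ‖x.1‖ ^ p + ‖x.2‖ ^ p = 1 ∧ ε ≤ ‖x.1 - x.2‖ ^ p} := by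
    refine Metric.isCompact_of_isClosed_isBounded ((isClosed_eq (cont_fst.add cont_snd)
      continuous_const).inter (isClosed_le continuous_const cont_sub)) ?_
    refine isBounded_iff_forall_norm_le.2 ⟨1, fun x hx => max_le ?_ ?_⟩
    · exact norm_le_one (norm_nonneg _) (norm_nonneg _) hx.1
    · exact norm_le_one (norm_nonneg _) (norm_nonneg _) ((add_comm _ _).trans hx.1)
  obtain ⟨δ, hδ, h⟩ := hK.exists_forall_le'
    (((cont_fst.add cont_snd).div_const 2).sub cont_mid).continuousOn (a := 0) fun x hx => by
      refine sub_pos.2 (norm_midpoint_rpow_lt hp fun hx' => ?_)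
      have := hx.2
      rw [hx', sub_self, norm_zero, Real.zero_rpow hp0.ne'] at this
      exact absurd this (not_le.2 hε)
  exact ⟨δ, hδ, fun a b hab hε => h (a, b) ⟨hab, hε⟩⟩

theorem exists_norm_sub_rpow_le_midpoint_gap [FiniteDimensional ℝ F] [StrictConvexSpace ℝ F]
    (hp : 1 < p) {ε : ℝ} (hε : 0 < ε) :
    ∃ C > 0, ∀ a b : F, ‖a - b‖ ^ p ≤ ε * (‖a‖ ^ p + ‖b‖ ^ p) +
      C * ((‖a‖ ^ p + ‖b‖ ^ p) / 2 - ‖(2⁻¹ : ℝ) • (a + b)‖ ^ p) := by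
  have hp0 : 0 < p := by linarith
  obtain ⟨δ, hδ, h⟩ := exists_pos_forall_le_midpoint_gap (F := F) hp hε
  refine ⟨2 ^ p / δ, by positivity, fun a b => ?_⟩
  set s := ‖a‖ ^ p + ‖b‖ ^ p with hs
  have gap_nonneg := sub_nonneg.2 (norm_midpoint_rpow_le hp.le a b)
  rcases le_or_gt (‖a - b‖ ^ p) (ε * s) with hle | hgt
  · exact hle.trans (le_add_of_nonneg_right (by positivity))
  have hs0 : 0 < s := by
    refine lt_of_le_of_ne (by positivity) fun hs0 => ?_
    have := norm_sub_rpow_le hp.le a b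
    rw [← hs, ← hs0, mul_zero] at this
    exact absurd (hgt.trans_le this) (by simp [← hs0])
  set c := s ^ (-(1 / p))
  have norm_smul_rpow : ∀ x : F, ‖c • x‖ ^ p = s⁻¹ * ‖x‖ ^ p := fun x => by
    rw [norm_smul, Real.norm_of_nonneg (by positivity), Real.mul_rpow (by positivity)
      (norm_nonneg x), ← Real.rpow_mul hs0.le, neg_mul, one_div_mul_cancel hp0.ne',
      Real.rpow_neg_one]
  have hnormalized := h (c • a) (c • b)
  rw [← smul_add, ← smul_sub, smul_comm, norm_smul_rpow, norm_smul_rpow, norm_smul_rpow,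
    norm_smul_rpow, ← mul_add, ← hs, inv_mul_cancel₀ hs0.ne', ← div_eq_inv_mul,
    ← div_eq_inv_mul, le_div_iff₀ hs0] at hnormalized
  have gap_ge : δ * s ≤ s / 2 - ‖(2⁻¹ : ℝ) • (a + b)‖ ^ p := by
    have := hnormalized rfl hgt.le
    rw [← div_self hs0.ne', div_right_comm, ← sub_div, le_div_iff₀ hs0] at this
    linarith
  calc ‖a - b‖ ^ p ≤ 2 ^ p * s := norm_sub_rpow_le hp.le a b
    _ = 2 ^ p / δ * (δ * s) := by field_simp
    _ ≤ 2 ^ p / δ * (s / 2 - ‖(2⁻¹ : ℝ) • (a + b)‖ ^ p) := by gcongr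
    _ ≤ _ := le_add_of_nonneg_left (by positivity)

end NormRpow

section Lp

variable {α F : Type*} [MeasurableSpace α] {μ : Measure α} [NormedAddCommGroup F] {p : ℝ}

theorem integrable_norm_rpow_of_memLp (hp : 0 < p) {f : α → F}
    (hf : MemLp f (ENNReal.ofReal p) μ) : Integrable (fun x => ‖f x‖ ^ p) μ := by
  have := hf.integrable_norm_rpow (by simpa using hp) ENNReal.ofReal_ne_top
  rwa [ENNReal.toReal_ofReal hp.le] at this

theorem norm_toLp_rpow (hp : 0 < p) {f : α → F} (hf : MemLp f (ENNReal.ofReal p) μ) :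
    ‖hf.toLp f‖ ^ p = ∫ x, ‖f x‖ ^ p ∂μ := by
  have h0 : 0 ≤ ∫ x, ‖f x‖ ^ p ∂μ := integral_nonneg fun x => by positivity
  rw [Lp.norm_toLp, hf.eLpNorm_eq_integral_rpow_norm (by simpa using hp) ENNReal.ofReal_ne_top,
    ENNReal.toReal_ofReal hp.le, ENNReal.toReal_ofReal (by positivity), ← Real.rpow_mul h0,
    inv_mul_cancel₀ hp.ne', Real.rpow_one]

theorem Lp_norm_rpow (hp : 0 < p) (f : Lp F (ENNReal.ofReal p) μ) :
    ‖f‖ ^ p = ∫ x, ‖f x‖ ^ p ∂μ := by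
  rw [← norm_toLp_rpow hp (Lp.memLp f), Lp.toLp_coeFn]

theorem Lp_exists_norm_sub_rpow_le_midpoint_gap [NormedSpace ℝ F] [FiniteDimensional ℝ F]
    [StrictConvexSpace ℝ F] [Fact (1 ≤ ENNReal.ofReal p)] (hp : 1 < p) {ε : ℝ} (hε : 0 < ε) :
    ∃ C > 0, ∀ f g : Lp F (ENNReal.ofReal p) μ, ‖f - g‖ ^ p ≤ ε * (‖f‖ ^ p + ‖g‖ ^ p) +
      C * ((‖f‖ ^ p + ‖g‖ ^ p) / 2 - ‖(2⁻¹ : ℝ) • (f + g)‖ ^ p) := by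
  have hp0 : 0 < p := by linarith
  obtain ⟨C, hC, h⟩ := exists_norm_sub_rpow_le_midpoint_gap (F := F) hp hε
  refine ⟨C, hC, fun f g => ?_⟩
  have int := fun f : Lp F (ENNReal.ofReal p) μ => integrable_norm_rpow_of_memLp hp0 (Lp.memLp f)
  have intfg : Integrable (fun x => ‖f x‖ ^ p + ‖g x‖ ^ p) μ := (int f).add (int g)
  have intgap : Integrable (fun x => (‖f x‖ ^ p + ‖g x‖ ^ p) / 2 -
      ‖((2⁻¹ : ℝ) • (f + g) : Lp F (ENNReal.ofReal p) μ) x‖ ^ p) μ :=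
    (intfg.div_const 2).sub (int _)
  simp only [Lp_norm_rpow hp0]
  calc ∫ x, ‖(f - g : Lp F (ENNReal.ofReal p) μ) x‖ ^ p ∂μ
      ≤ ∫ x, ε * (‖f x‖ ^ p + ‖g x‖ ^ p) + C * ((‖f x‖ ^ p + ‖g x‖ ^ p) / 2 -
          ‖((2⁻¹ : ℝ) • (f + g) : Lp F (ENNReal.ofReal p) μ) x‖ ^ p) ∂μ := by
        refine integral_mono_ae (int _) ((intfg.const_mul ε).add (intgap.const_mul C)) ?_
        filter_upwards [Lp.coeFn_sub f g, Lp.coeFn_smul (2⁻¹ : ℝ) (f + g), Lp.coeFn_add f g]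
          with x hsub hsmul hadd
        rw [hsub, hsmul, Pi.smul_apply, hadd]
        exact h (f x) (g x)
    _ = _ := by
        rw [integral_add (intfg.const_mul ε) (intgap.const_mul C), integral_const_mul,
          integral_const_mul, integral_sub (intfg.div_const 2) (int _), integral_div,
          integral_add (int f) (int g)]

theorem uniformConvexSpace_Lp [NormedSpace ℝ F] [FiniteDimensional ℝ F] [StrictConvexSpace ℝ F]
    [Fact (1 ≤ ENNReal.ofReal p)] (hp : 1 < p) :
    UniformConvexSpace (Lp F (ENNReal.ofReal p) μ) := by
  have hp0 : 0 < p := by linarith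
  refine ⟨fun ε hε => ?_⟩
  obtain ⟨C, hC, h⟩ := Lp_exists_norm_sub_rpow_le_midpoint_gap (F := F) (μ := μ) hp
    (by positivity : 0 < ε ^ p / 4)
  refine ⟨ε ^ p / (C * p), by positivity, fun f hf g hg hfg => ?_⟩
  have hle := (Real.rpow_le_rpow hε.le hfg hp0.le).trans (h f g)
  rw [norm_inv_two_smul_add, hf, hg, Real.one_rpow] at hle
  have bernoulli := one_add_mul_self_le_rpow_one_add
    (by linarith [norm_nonneg (f + g)] : -1 ≤ ‖f + g‖ / 2 - 1) hp.le
  rw [add_sub_cancel] at bernoulli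
  have hgap : ε ^ p / 2 ≤ C * (p * (1 - ‖f + g‖ / 2)) := by
    have := mul_le_mul_of_nonneg_left bernoulli hC.le
    linarith
  have hdiv : ε ^ p / (C * p) / 2 ≤ 1 - ‖f + g‖ / 2 := by
    rw [div_right_comm, div_le_iff₀ (by positivity)]
    linarith
  linarith

end Lp

section MinNorm

variable {X : Type*} [NormedAddCommGroup X] [NormedSpace ℝ X] [UniformConvexSpace X]

theorem exists_pos_forall_norm_sub_lt {d ε : ℝ} (hd : 0 ≤ d) (hε : 0 < ε) :
    ∃ η > 0, ∀ x y : X, ‖x‖ ≤ d + η → ‖y‖ ≤ d + η → 2 * d ≤ ‖x + y‖ → ‖x - y‖ < ε := by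
  rcases hd.eq_or_lt with rfl | hd
  · refine ⟨ε / 3, by positivity, fun x y hx hy _ => ?_⟩
    linarith [norm_sub_le x y]
  obtain ⟨δ, hδ, h⟩ := exists_forall_closed_ball_dist_add_le_two_mul_sub X (half_pos hε) d
  refine ⟨min d (δ / 3), by positivity, fun x y hx hy hxy => ?_⟩
  set η := min d (δ / 3)
  have hηd : η ≤ d := min_le_left _ _
  have hηδ : η ≤ δ / 3 := min_le_right _ _
  have hη : 0 < η := by positivity
  have norm_scale : ∀ z : X, ‖(d / (d + η)) • z‖ = d / (d + η) * ‖z‖ := fun z => by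
    rw [norm_smul, Real.norm_of_nonneg (by positivity)]
  have scale_le : ∀ {z : X}, ‖z‖ ≤ d + η → ‖(d / (d + η)) • z‖ ≤ d := fun {z} hz => by
    rw [norm_scale, div_mul_eq_mul_div, div_le_iff₀ (by positivity)]
    gcongr
  by_contra! hε_le
  have far : ε / 2 ≤ ‖(d / (d + η)) • x - (d / (d + η)) • y‖ := by
    rw [← smul_sub, norm_scale, div_mul_eq_mul_div, le_div_iff₀ (by positivity)]
    nlinarith
  have hsum := h (scale_le hx) (scale_le hy) far
  rw [← smul_add, norm_scale, div_mul_eq_mul_div, div_le_iff₀ (by positivity)] at hsum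
  nlinarith

theorem exists_forall_norm_le_of_isComplete_convex {K : Set X} (hne : K.Nonempty)
    (hK : IsComplete K) (hconv : Convex ℝ K) : ∃ z ∈ K, ∀ y ∈ K, ‖z‖ ≤ ‖y‖ := by
  set d := sInf (norm '' K)
  have hbdd : BddBelow (norm '' K) := ⟨0, by rintro _ ⟨y, -, rfl⟩; exact norm_nonneg y⟩
  have hd : ∀ y ∈ K, d ≤ ‖y‖ := fun y hy => csInf_le hbdd ⟨y, hy, rfl⟩
  have hd0 : 0 ≤ d := le_csInf (hne.image _) (by rintro _ ⟨y, -, rfl⟩; exact norm_nonneg y)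
  have hadd : ∀ x ∈ K, ∀ y ∈ K, 2 * d ≤ ‖x + y‖ := fun x hx y hy => by
    have := hd _ (hconv hx hy (by positivity : (0 : ℝ) ≤ 2⁻¹) (by positivity : (0 : ℝ) ≤ 2⁻¹)
      (by norm_num))
    rw [← smul_add, norm_inv_two_smul_add] at this
    linarith
  obtain ⟨s, -, hs, hsK⟩ := exists_seq_tendsto_sInf (hne.image norm) hbdd
  choose y hyK hys using hsK
  obtain rfl : (fun n => ‖y n‖) = s := funext hys
  have hcauchy : CauchySeq y := Metric.cauchySeq_iff.2 fun ε hε => by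
    obtain ⟨η, hη, h⟩ := exists_pos_forall_norm_sub_lt (X := X) hd0 hε
    obtain ⟨N, hN⟩ := eventually_atTop.1 (hs.eventually_le_const (lt_add_of_pos_right d hη))
    refine ⟨N, fun m hm n hn => ?_⟩
    rw [dist_eq_norm]
    exact h _ _ (hN m hm) (hN n hn) (hadd _ (hyK m) _ (hyK n))
  obtain ⟨z, hzK, hz⟩ := cauchySeq_tendsto_of_isComplete hK hyK hcauchy
  exact ⟨z, hzK, fun x hx => (tendsto_nhds_unique hz.norm hs).le.trans (hd x hx)⟩

end MinNorm

section EnergyMinimizer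

variable {X Z : Type*} [NormedAddCommGroup X] [NormedSpace ℝ X] [CompleteSpace X]
  [NormedAddCommGroup Z] [NormedSpace ℝ Z] [CompleteSpace Z] {W : Submodule ℝ (X × Z)} {C p q : ℝ}

theorem isComplete_snd_image_of_norm_fst_le (hW : IsClosed (W : Set (X × Z)))
    (hC : ∀ w ∈ W, ‖w.1‖ ≤ C * ‖w.2‖) {S : Set X} (hS : IsClosed S) :
    IsComplete (Prod.snd '' {w | w ∈ W ∧ w.1 ∈ S}) := by
  have := hW.completeSpace_coe
  have hanti : AntilipschitzWith (max C 1).toNNReal ((LinearMap.snd ℝ X Z).comp W.subtype) := by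
    refine AddMonoidHomClass.antilipschitz_of_bound _ fun w => ?_
    rw [Real.coe_toNNReal _ (zero_le_one.trans (le_max_right _ _))]
    refine max_le ((hC w w.2).trans ?_) ?_
    · exact mul_le_mul_of_nonneg_right (le_max_left _ _) (norm_nonneg _)
    · exact le_mul_of_one_le_left (norm_nonneg _) (le_max_right _ _)
  have huniform := hanti.isUniformInducing
    (uniformContinuous_snd.comp uniformContinuous_subtype_val)
  have hclosed : IsClosed {w : W | w.1.1 ∈ S} :=
    hS.preimage (continuous_fst.comp continuous_subtype_val)
  have himage : Prod.snd '' {w | w ∈ W ∧ w.1 ∈ S} =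
      (LinearMap.snd ℝ X Z).comp W.subtype '' {w : W | w.1.1 ∈ S} := by
    ext z
    simp [and_comm]
  rw [himage]
  exact huniform.isComplete_iff.2 hclosed.isComplete

theorem exists_forall_apply_fst_mul_norm_snd_le [UniformConvexSpace Z]
    (hW : IsClosed (W : Set (X × Z))) (hC : ∀ w ∈ W, ‖w.1‖ ≤ C * ‖w.2‖) (ℓ : X →L[ℝ] ℝ)
    (hℓ : ∃ w ∈ W, ℓ w.1 ≠ 0) :
    ∃ w ∈ W, ℓ w.1 = 1 ∧ ∀ v ∈ W, ℓ v.1 * ‖w.2‖ ≤ ‖v.2‖ := by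
  have normalized_mem : ∀ {v}, v ∈ W → ℓ v.1 ≠ 0 →
      (ℓ v.1)⁻¹ • v ∈ {w | w ∈ W ∧ w.1 ∈ ℓ ⁻¹' {1}} := fun hv h =>
    ⟨W.smul_mem _ hv, by simp [h]⟩
  have hconv : Convex ℝ (Prod.snd '' {w | w ∈ W ∧ w.1 ∈ ℓ ⁻¹' {1}}) :=
    (W.convex.inter (((convex_singleton 1).linear_preimage ℓ.toLinearMap).linear_preimage
      (LinearMap.fst ℝ X Z))).linear_image (LinearMap.snd ℝ X Z)
  obtain ⟨v, hv, hv0⟩ := hℓ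
  obtain ⟨-, ⟨w, ⟨hw, hw1⟩, rfl⟩, hmin⟩ := exists_forall_norm_le_of_isComplete_convex
    ⟨_, Set.mem_image_of_mem _ (normalized_mem hv hv0)⟩
    (isComplete_snd_image_of_norm_fst_le hW hC (isClosed_singleton.preimage ℓ.continuous)) hconv
  refine ⟨w, hw, hw1, fun v hv => ?_⟩
  rcases le_or_gt (ℓ v.1) 0 with hle | hlt
  · exact (mul_nonpos_of_nonpos_of_nonneg hle (norm_nonneg _)).trans (norm_nonneg _)
  · have h := hmin _ ⟨_, normalized_mem hv hlt.ne', rfl⟩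
    rwa [Prod.smul_snd, norm_smul, norm_inv, Real.norm_of_nonneg hlt.le,
      le_inv_mul_iff₀ hlt] at h

theorem exists_forall_apply_fst_le_rpow_mul_norm_snd [UniformConvexSpace Z]
    (hW : IsClosed (W : Set (X × Z))) (hC : ∀ w ∈ W, ‖w.1‖ ≤ C * ‖w.2‖) (ℓ : X →L[ℝ] ℝ)
    (hp : 1 < p) :
    ∃ w ∈ W, ℓ w.1 = ‖w.2‖ ^ p ∧ ∀ v ∈ W, ℓ v.1 ≤ ‖w.2‖ ^ (p - 1) * ‖v.2‖ := by
  have hp1 : p - 1 ≠ 0 := by linarith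
  by_cases hℓ : ∃ w ∈ W, ℓ w.1 ≠ 0
  · obtain ⟨w, hw, hw1, hmin⟩ := exists_forall_apply_fst_mul_norm_snd_le hW hC ℓ hℓ
    have hpos : 0 < ‖w.2‖ := (norm_nonneg _).lt_of_ne' fun h0 => by
      have := hC w hw
      rw [h0, mul_zero, norm_le_zero_iff] at this
      simp [this] at hw1
    set c : ℝ := (‖w.2‖ ^ p) ^ (-(p - 1)⁻¹)
    have hc : 0 < c := by positivity
    have hc_rpow : c ^ (p - 1) * ‖w.2‖ ^ p = 1 := by
      rw [← Real.rpow_mul (by positivity), neg_mul, inv_mul_cancel₀ hp1, Real.rpow_neg_one,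
        inv_mul_cancel₀ (by positivity)]
    have norm_smul_rpow : ∀ r : ℝ, ‖(c • w).2‖ ^ r = c ^ r * ‖w.2‖ ^ r := fun r => by
      rw [Prod.smul_snd, norm_smul, Real.norm_of_nonneg hc.le, Real.mul_rpow hc.le hpos.le]
    refine ⟨c • w, W.smul_mem c hw, ?_, fun v hv => ?_⟩
    · rw [norm_smul_rpow, Prod.smul_fst, map_smul, hw1, smul_eq_mul, ← hc_rpow, ← mul_assoc,
        ← Real.rpow_one_add' hc.le (by linarith), add_sub_cancel]
    · calc ℓ v.1 = c ^ (p - 1) * ‖w.2‖ ^ (p - 1) * (ℓ v.1 * ‖w.2‖) := by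
            rw [mul_comm (ℓ v.1), ← mul_assoc, mul_assoc (c ^ _),
              ← Real.rpow_add_one hpos.ne', sub_add_cancel, hc_rpow, one_mul]
        _ ≤ ‖(c • w).2‖ ^ (p - 1) * ‖v.2‖ := by
            rw [norm_smul_rpow]
            gcongr
            exact hmin v hv
  · push Not at hℓ
    refine ⟨0, W.zero_mem, by simp [(zero_lt_one.trans hp).ne'], fun v hv => ?_⟩
    rw [hℓ v hv]
    positivity

theorem exists_forall_norm_snd_rpow_div_sub_apply_fst_le [UniformConvexSpace Z]
    (hW : IsClosed (W : Set (X × Z))) (hC : ∀ w ∈ W, ‖w.1‖ ≤ C * ‖w.2‖) (ℓ : X →L[ℝ] ℝ)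
    (hpq : p.HolderConjugate q) :
    ∃ w ∈ W, ∀ v ∈ W, ‖w.2‖ ^ p / p - ℓ w.1 ≤ ‖v.2‖ ^ p / p - ℓ v.1 := by
  obtain ⟨w, hw, hℓw, hle⟩ := exists_forall_apply_fst_le_rpow_mul_norm_snd hW hC ℓ hpq.lt
  refine ⟨w, hw, fun v hv => ?_⟩
  have young := Real.young_inequality_of_nonneg (norm_nonneg v.2)
    (Real.rpow_nonneg (norm_nonneg w.2) (p - 1)) hpq
  rw [← Real.rpow_mul (norm_nonneg _), hpq.sub_one_mul_conj] at young
  have hsplit : ‖w.2‖ ^ p / p + ‖w.2‖ ^ p / q = ‖w.2‖ ^ p := by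
    rw [div_eq_mul_inv, div_eq_mul_inv, ← mul_add, hpq.inv_add_inv_eq_one, mul_one]
  linarith [hle v hv]

end EnergyMinimizer

section FirstVariation

variable {α F : Type*} [MeasurableSpace α] {μ : Measure α} [NormedAddCommGroup F]
  [InnerProductSpace ℝ F] {p : ℝ}

theorem abs_norm_rpow_mul_inner_le (hp : 1 < p) (a b : F) :
    |‖a‖ ^ (p - 2) * inner ℝ a b| ≤ ‖a‖ ^ (p - 1) * ‖b‖ := by
  rw [abs_mul, abs_of_nonneg (by positivity)]
  calc ‖a‖ ^ (p - 2) * |inner ℝ a b| ≤ ‖a‖ ^ (p - 2) * (‖a‖ * ‖b‖) := by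
        gcongr
        exact abs_real_inner_le_norm a b
    _ = ‖a‖ ^ (p - 1) * ‖b‖ := by
        rw [← mul_assoc, ← Real.rpow_add_one' (norm_nonneg a) (by linarith)]
        ring_nf

theorem hasDerivAt_norm_add_smul_rpow (hp : 1 < p) (a b : F) (t : ℝ) :
    HasDerivAt (fun t : ℝ => ‖a + t • b‖ ^ p)
      (p * (‖a + t • b‖ ^ (p - 2) * inner ℝ (a + t • b) b)) t := by
  have hline : HasDerivAt (fun t : ℝ => a + t • b) b t := by
    simpa using ((hasDerivAt_id t).smul_const b).const_add a
  refine ((hasFDerivAt_norm_rpow _ hp).comp_hasDerivAt t hline).congr_deriv ?_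
  simp [mul_assoc, inner_add_left, real_inner_smul_left, mul_add]

theorem hasDerivAt_integral_norm_add_smul_rpow (hp : 1 < p) {G H : α → F}
    (hG : MemLp G (ENNReal.ofReal p) μ) (hH : MemLp H (ENNReal.ofReal p) μ) :
    HasDerivAt (fun t : ℝ => ∫ x, ‖G x + t • H x‖ ^ p ∂μ)
      (∫ x, p * (‖G x‖ ^ (p - 2) * inner ℝ (G x) (H x)) ∂μ) 0 := by
  have hp0 : 0 < p := by linarith
  have memLp_line : ∀ t : ℝ, MemLp (fun x => G x + t • H x) (ENNReal.ofReal p) μ :=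
    fun t => hG.add (hH.const_smul t)
  have int_bound : Integrable (fun x => p * (‖G x‖ + ‖H x‖) ^ p) μ := by
    have := integrable_norm_rpow_of_memLp hp0 (hG.norm.add hH.norm)
    refine (this.congr (.of_forall fun x => ?_)).const_mul p
    simp only [Pi.add_apply]
    rw [Real.norm_of_nonneg (by positivity)]
  have hderiv := hasDerivAt_integral_of_dominated_loc_of_deriv_le (μ := μ) (x₀ := (0 : ℝ))
    (F := fun t x => ‖G x + t • H x‖ ^ p)
    (F' := fun t x => p * (‖G x + t • H x‖ ^ (p - 2) * inner ℝ (G x + t • H x) (H x)))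
    (Metric.ball_mem_nhds _ one_pos)
    (.of_forall fun t => (integrable_norm_rpow_of_memLp hp0 (memLp_line t)).1)
    (integrable_norm_rpow_of_memLp hp0 (memLp_line 0)) ?_ ?_ int_bound
    (.of_forall fun x t _ => hasDerivAt_norm_add_smul_rpow hp _ _ t)
  · simpa only [zero_smul, add_zero] using hderiv.2
  · refine .const_mul (.mul ?_ ((memLp_line 0).1.inner hH.1)) _
    exact ((memLp_line 0).1.norm.aemeasurable.pow_const _).aestronglyMeasurable
  · refine .of_forall fun x t ht => ?_
    have ht1 : |t| ≤ 1 := by simpa using (mem_ball_zero_iff.1 ht).le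
    have norm_line_le : ‖G x + t • H x‖ ≤ ‖G x‖ + ‖H x‖ := by
      refine (norm_add_le _ _).trans (add_le_add_right ?_ _)
      rw [norm_smul]
      exact mul_le_of_le_one_left (norm_nonneg _) ht1
    rw [norm_mul, Real.norm_of_nonneg hp0.le]
    gcongr
    calc ‖‖G x + t • H x‖ ^ (p - 2) * inner ℝ (G x + t • H x) (H x)‖
        ≤ ‖G x + t • H x‖ ^ (p - 1) * ‖H x‖ := abs_norm_rpow_mul_inner_le hp _ _
      _ ≤ (‖G x‖ + ‖H x‖) ^ (p - 1) * (‖G x‖ + ‖H x‖) := by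
          gcongr
          exact le_add_of_nonneg_left (norm_nonneg _)
      _ = (‖G x‖ + ‖H x‖) ^ p := by
          rw [← Real.rpow_add_one' (by positivity) (by linarith), sub_add_cancel]

theorem integral_norm_rpow_mul_inner_eq_of_forall_le (hp : 1 < p) {G H : α → F}
    (hG : MemLp G (ENNReal.ofReal p) μ) (hH : MemLp H (ENNReal.ofReal p) μ) {b : ℝ}
    (h : ∀ t : ℝ, (∫ x, ‖G x‖ ^ p ∂μ) / p ≤ (∫ x, ‖G x + t • H x‖ ^ p ∂μ) / p - t * b) :
    ∫ x, ‖G x‖ ^ (p - 2) * inner ℝ (G x) (H x) ∂μ = b := by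
  have hderiv := ((hasDerivAt_integral_norm_add_smul_rpow hp hG hH).div_const p).sub
    ((hasDerivAt_id (0 : ℝ)).mul_const b)
  have hmin : IsLocalMin ((fun t : ℝ => (∫ x, ‖G x + t • H x‖ ^ p ∂μ) / p) -
      fun t => id t * b) 0 := .of_forall fun t => by simpa using h t
  have hzero := hmin.hasDerivAt_eq_zero hderiv
  rw [integral_const_mul, mul_div_cancel_left₀ _ (by linarith)] at hzero
  linarith

end FirstVariation

/-! ### Existence of the torsion function -/

section Existence

variable {D : ℕ} {p q : ℝ} {Ω : Set (E D)}

/-- The pairs `(φ, ∇φ)`, `φ ∈ C_c^∞(Ω)`, as a subspace of `L^p × L^p`. Its closure represents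
`W_0^{1,p}(Ω)`. -/
noncomputable def testPairs (p : ℝ) (Ω : Set (E D)) [Fact (1 ≤ ENNReal.ofReal p)] :
    Submodule ℝ (Lp ℝ (ENNReal.ofReal p) (volume.restrict Ω) ×
      Lp (E D) (ENNReal.ofReal p) (volume.restrict Ω)) where
  carrier := {w | ∃ φ, IsTestFunction Ω φ ∧ w.1 =ᵐ[volume.restrict Ω] φ ∧
    w.2 =ᵐ[volume.restrict Ω] gradient φ}
  zero_mem' := by
    refine ⟨0, .zero, Lp.coeFn_zero _ _ _, (Lp.coeFn_zero _ _ _).trans (.of_eq ?_)⟩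
    exact funext fun x => (gradient_fun_const x 0).symm
  add_mem' := by
    rintro v w ⟨φ, hφ, hvφ, hv⟩ ⟨ψ, hψ, hwψ, hw⟩
    refine ⟨φ + ψ, hφ.add hψ, (Lp.coeFn_add _ _).trans (hvφ.add hwψ),
      (Lp.coeFn_add _ _).trans ((hv.add hw).trans (.of_eq ?_))⟩
    exact funext fun x => (gradient_add (hφ.differentiable x) (hψ.differentiable x)).symm
  smul_mem' := by
    rintro c w ⟨φ, hφ, hwφ, hw⟩
    refine ⟨c • φ, hφ.smul c, (Lp.coeFn_smul _ _).trans (hwφ.const_smul c),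
      (Lp.coeFn_smul _ _).trans ((hw.const_smul c).trans (.of_eq ?_))⟩
    exact funext fun x => (gradient_const_smul c (hφ.differentiable x)).symm

section

variable [Fact (1 ≤ ENNReal.ofReal p)] {w : Lp ℝ (ENNReal.ofReal p) (volume.restrict Ω) ×
  Lp (E D) (ENNReal.ofReal p) (volume.restrict Ω)}

theorem MemWZero.mem_closure_testPairs {u : E D → ℝ} {G : E D → E D} (h : MemWZero p Ω u G) :
    (h.1.1.toLp u, h.1.2.1.toLp G) ∈ (testPairs p Ω).topologicalClosure := by
  obtain ⟨φ, hφ, hφu, hφG⟩ := h.2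
  exact mem_closure_of_tendsto (Tendsto.prodMk_nhds
    ((Lp.tendsto_Lp_iff_tendsto_eLpNorm'' _ (fun n => (hφ n).memLp _) _ _).2 hφu)
    ((Lp.tendsto_Lp_iff_tendsto_eLpNorm'' _ (fun n => (hφ n).memLp_gradient _) _ _).2 hφG))
    (.of_forall fun n =>
      ⟨φ n, hφ n, ((hφ n).memLp _).coeFn_toLp, ((hφ n).memLp_gradient _).coeFn_toLp⟩)

theorem memWZero_of_mem_closure_testPairs (hpq : p.HolderConjugate q)
    (hw : w ∈ (testPairs p Ω).topologicalClosure) : MemWZero p Ω w.1 w.2 := by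
  obtain ⟨s, hs, hlim⟩ := mem_closure_iff_seq_limit.1 hw
  choose φ hφ hsφ hsG using hs
  have lim_fst := (Lp.tendsto_Lp_iff_tendsto_eLpNorm' _ _).1 ((continuous_fst.tendsto _).comp hlim)
  have lim_snd := (Lp.tendsto_Lp_iff_tendsto_eLpNorm' _ _).1 ((continuous_snd.tendsto _).comp hlim)
  refine memWZero_of_tendsto hpq hφ (Lp.memLp _) (Lp.memLp _) ?_ ?_
  · refine lim_fst.congr fun n => eLpNorm_congr_ae ?_
    exact (hsφ n).sub .rfl
  · refine lim_snd.congr fun n => eLpNorm_congr_ae ?_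
    exact (hsG n).sub .rfl

theorem norm_fst_le_of_mem_closure_testPairs (hpq : p.HolderConjugate q) {i : Fin D} {c ρ : ℝ}
    (hρ : 0 ≤ ρ) (hΩ : ∀ x ∈ Ω, |x i - c| ≤ ρ) (hw : w ∈ (testPairs p Ω).topologicalClosure) :
    ‖w.1‖ ≤ (ρ * p) * ‖w.2‖ := by
  have hclosed : IsClosed {w : Lp ℝ (ENNReal.ofReal p) (volume.restrict Ω) ×
      Lp (E D) (ENNReal.ofReal p) (volume.restrict Ω) | ‖w.1‖ ≤ (ρ * p) * ‖w.2‖} :=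
    isClosed_le (by fun_prop) (by fun_prop)
  refine closure_minimal ?_ hclosed hw
  rintro w ⟨φ, hφ, hwφ, hw⟩
  have hp := hpq.pos
  have norm_fst_rpow : ‖w.1‖ ^ p = ∫ x, ‖φ x‖ ^ p := by
    rw [Lp_norm_rpow hp, ← hφ.setIntegral_eq fun x hx => by
      rw [image_eq_zero_of_notMem_tsupport hx, norm_zero, Real.zero_rpow hp.ne']]
    exact integral_congr_ae (hwφ.mono fun x hx => by simp only [hx])
  have norm_snd_rpow : ‖w.2‖ ^ p = ∫ x, ‖gradient φ x‖ ^ p := by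
    rw [Lp_norm_rpow hp, ← hφ.setIntegral_eq fun x hx => by
      rw [gradient_of_notMem_tsupport hx, norm_zero, Real.zero_rpow hp.ne']]
    exact integral_congr_ae (hw.mono fun x hx => by simp only [hx])
  refine (Real.rpow_le_rpow_iff (norm_nonneg _) (by positivity) hp).1 ?_
  rw [Real.mul_rpow (by positivity) (norm_nonneg _), norm_fst_rpow, norm_snd_rpow]
  exact poincare_of_tsupport_subset_slab hpq hφ.contDiff_one hφ.2.1 hρ
    fun x hx => hΩ x (hφ.2.2 hx)

end

theorem exists_clm_forall_apply_eq_integral {α : Type*} [MeasurableSpace α] {μ : Measure α}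
    [IsFiniteMeasure μ] [Fact (1 ≤ ENNReal.ofReal p)] (hpq : p.HolderConjugate q) :
    ∃ ℓ : Lp ℝ (ENNReal.ofReal p) μ →L[ℝ] ℝ, ∀ f, ℓ f = ∫ x, f x ∂μ := by
  have := hpq.ennrealOfReal
  have : Fact (1 ≤ ENNReal.ofReal q) := ⟨ENNReal.one_le_ofReal.2 hpq.symm.lt.le⟩
  refine ⟨((ContinuousLinearMap.mul ℝ ℝ).lpPairing μ (ENNReal.ofReal p) (ENNReal.ofReal q)).flip
    (MemLp.toLp (fun _ => 1) (memLp_const 1)), fun f => ?_⟩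
  rw [ContinuousLinearMap.flip_apply, ContinuousLinearMap.lpPairing_eq_integral]
  refine integral_congr_ae ?_
  filter_upwards [(memLp_const (1 : ℝ) (p := ENNReal.ofReal q) (μ := μ)).coeFn_toLp] with x hx
  rw [ContinuousLinearMap.mul_apply', hx, mul_one]

/-- `u ∈ W_0^{1,p}(Ω)`, with weak gradient `G`, solves `-Δ_p u = 1` weakly: `IsTorsionFunction`
with the weak gradient made explicit. -/
def IsWeakSolution (p : ℝ) (Ω : Set (E D)) (u : E D → ℝ) (G : E D → E D) : Prop :=
  MemWZero p Ω u G ∧ ∀ (v : E D → ℝ) (H : E D → E D), MemWZero p Ω v H →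
    ∫ x in Ω, ‖G x‖ ^ (p - 2) * inner ℝ (G x) (H x) = ∫ x in Ω, v x

theorem exists_isWeakSolution [IsFiniteMeasure (volume.restrict Ω)] (hpq : p.HolderConjugate q)
    {i : Fin D} {c ρ : ℝ} (hρ : 0 ≤ ρ) (hΩ : ∀ x ∈ Ω, |x i - c| ≤ ρ) :
    ∃ u G, IsWeakSolution p Ω u G := by
  have : Fact (1 ≤ ENNReal.ofReal p) := ⟨ENNReal.one_le_ofReal.2 hpq.lt.le⟩
  have := uniformConvexSpace_Lp (F := E D) (μ := volume.restrict Ω) hpq.lt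
  obtain ⟨ℓ, hℓ⟩ := exists_clm_forall_apply_eq_integral (μ := volume.restrict Ω) hpq
  obtain ⟨w, hw, hmin⟩ := exists_forall_norm_snd_rpow_div_sub_apply_fst_le
    (testPairs p Ω).isClosed_topologicalClosure
    (fun w hw => norm_fst_le_of_mem_closure_testPairs hpq hρ hΩ hw) ℓ hpq
  refine ⟨w.1, w.2, memWZero_of_mem_closure_testPairs hpq hw, fun v H hv => ?_⟩
  have hH := hv.1.2.1
  refine integral_norm_rpow_mul_inner_eq_of_forall_le hpq.lt (Lp.memLp w.2) hH fun t => ?_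
  have hle := hmin _ (Submodule.add_mem _ hw (Submodule.smul_mem _ t hv.mem_closure_testPairs))
  have norm_snd_rpow : ‖w.2 + t • hH.toLp H‖ ^ p = ∫ x in Ω, ‖w.2 x + t • H x‖ ^ p := by
    rw [Lp_norm_rpow hpq.pos]
    refine integral_congr_ae ?_
    filter_upwards [Lp.coeFn_add w.2 (t • hH.toLp H), Lp.coeFn_smul t (hH.toLp H),
      hH.coeFn_toLp] with x hadd hsmul htoLp
    rw [hadd, Pi.add_apply, hsmul, Pi.smul_apply, htoLp]
  have apply_toLp : ℓ (hv.1.1.toLp v) = ∫ x in Ω, v x :=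
    (hℓ _).trans (integral_congr_ae hv.1.1.coeFn_toLp)
  rw [Prod.snd_add, Prod.smul_snd, Prod.fst_add, Prod.smul_fst, map_add, map_smul, norm_snd_rpow,
    apply_toLp, Lp_norm_rpow hpq.pos, smul_eq_mul] at hle
  linarith

theorem exists_isWeakSolution_torsionFunction (h : ∃ u G, IsWeakSolution p Ω u G) :
    ∃ G, IsWeakSolution p Ω (torsionFunction p Ω) G := by
  have h' : ∃ u, IsTorsionFunction p Ω u := h
  rw [torsionFunction, dif_pos h']
  exact h'.choose_spec

end Existence

/-! ### Bounds for the torsional rigidity -/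

section Bounds

variable {D : ℕ} {p q : ℝ} {Ω : Set (E D)} {u v : E D → ℝ} {G H : E D → E D}

theorem memLp_norm_rpow_sub_one {α F : Type*} [MeasurableSpace α] {μ : Measure α}
    [NormedAddCommGroup F] (hpq : p.HolderConjugate q) {f : α → F}
    (hf : MemLp f (ENNReal.ofReal p) μ) :
    MemLp (fun x => ‖f x‖ ^ (p - 1)) (ENNReal.ofReal q) μ := by
  have h := hf.norm_rpow_div (ENNReal.ofReal (p - 1))
  rwa [ENNReal.toReal_ofReal hpq.sub_one_pos.le, ← ENNReal.ofReal_div_of_pos hpq.sub_one_pos,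
    ← hpq.conjugate_eq] at h

namespace IsWeakSolution

theorem setIntegral_eq (h : IsWeakSolution p Ω u G) (hp : p ≠ 0) :
    ∫ x in Ω, u x = ∫ x in Ω, ‖G x‖ ^ p := by
  rw [← h.2 u G h.1]
  congr! 2 with x
  rw [real_inner_self_eq_norm_sq, ← Real.rpow_natCast, ← Real.rpow_add' (norm_nonneg _)] <;>
    simp [hp]

theorem setIntegral_nonneg (h : IsWeakSolution p Ω u G) (hp : p ≠ 0) : 0 ≤ ∫ x in Ω, u x := by
  rw [h.setIntegral_eq hp]
  exact integral_nonneg fun x => by positivity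

theorem setIntegral_le (h : IsWeakSolution p Ω u G) (hpq : p.HolderConjugate q)
    (hv : MemWZero p Ω v H) :
    ∫ x in Ω, v x ≤ (∫ x in Ω, u x) ^ (1 / q) * (∫ x in Ω, ‖H x‖ ^ p) ^ (1 / p) := by
  have := hpq.symm.ennrealOfReal
  have memLp_G := memLp_norm_rpow_sub_one hpq h.1.1.2.1
  have holder := integral_mul_le_Lp_mul_Lq_of_nonneg hpq.symm (.of_forall fun x => by positivity)
    (.of_forall fun x => norm_nonneg (H x)) memLp_G hv.1.2.1.norm
  simp only [← Real.rpow_mul (norm_nonneg _), hpq.sub_one_mul_conj] at holder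
  rw [h.setIntegral_eq hpq.ne_zero, ← h.2 v H hv]
  refine ((Real.le_norm_self _).trans (norm_integral_le_of_norm_le
    (memLp_G.integrable_mul hv.1.2.1.norm) (.of_forall fun x => ?_))).trans holder
  exact abs_norm_rpow_mul_inner_le hpq.lt (G x) (H x)

theorem setIntegral_le_setIntegral_abs_coord_rpow [IsFiniteMeasure (volume.restrict Ω)]
    (h : IsWeakSolution p Ω u G) (hpq : p.HolderConjugate q) {i : Fin D} {c ρ : ℝ}
    (hΩ : ∀ᵐ x ∂volume.restrict Ω, |x i - c| ≤ ρ) :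
    ∫ x in Ω, u x ≤ ∫ x in Ω, |x i - c| ^ q := by
  have := hpq.symm.ennrealOfReal
  have memLp_coord : MemLp (fun x : E D => |x i - c|) (ENNReal.ofReal q) (volume.restrict Ω) :=
    .of_bound (contDiff_coord_sub i c (n := 0)).continuous.abs.aestronglyMeasurable ρ
      (by simpa only [Real.norm_eq_abs, abs_abs] using hΩ)
  have holder := integral_mul_le_Lp_mul_Lq_of_nonneg hpq.symm (.of_forall fun x => abs_nonneg _)
    (.of_forall fun x => norm_nonneg _) memLp_coord h.1.1.2.1.norm
  have integral_le : ∫ x in Ω, u x ≤ ∫ x in Ω, |x i - c| * ‖G x‖ := by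
    rw [h.1.setIntegral_eq_neg_setIntegral_coord_mul hpq hΩ, ← integral_neg]
    refine (Real.le_norm_self _).trans (norm_integral_le_of_norm_le
      (memLp_coord.integrable_mul h.1.1.2.1.norm) (.of_forall fun x => ?_))
    rw [norm_neg, norm_mul]
    exact mul_le_mul_of_nonneg_left (PiLp.norm_apply_le _ _) (norm_nonneg _)
  rw [← h.setIntegral_eq hpq.ne_zero, mul_comm] at holder
  simpa using le_rpow_mul_of_le_mul_rpow_mul_rpow hpq.symm (h.setIntegral_nonneg hpq.ne_zero)
    (integral_nonneg fun x => by positivity) zero_le_one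
    ((integral_le.trans holder).trans_eq (one_mul _).symm)

end IsWeakSolution

end Bounds

/-! ### Mollified strip profiles -/

section Mollification

open scoped Convolution
open ContinuousLinearMap (lsmul)

variable {F : Type*} [NormedAddCommGroup F] [NormedSpace ℝ F] [FiniteDimensional ℝ F]
  [MeasurableSpace F] [BorelSpace F] {μ : Measure F} [μ.IsAddHaarMeasure]
  (b : ContDiffBump (0 : F)) {f : F → ℝ} {x y : F}

theorem integrable_normed_mul_comp_sub (hf : Continuous f) (x : F) :
    Integrable (fun t => b.normed μ t * f (x - t)) μ :=
  (b.continuous_normed.mul (by fun_prop)).integrable_of_hasCompactSupport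
    b.hasCompactSupport_normed.mul_right

theorem le_normed_convolution (hf : Continuous f) {c : ℝ}
    (h : ∀ y ∈ Metric.ball x b.rOut, c ≤ f y) : c ≤ (b.normed μ ⋆[lsmul ℝ ℝ, μ] f) x := by
  calc c = ∫ t, b.normed μ t * c ∂μ := by rw [integral_mul_const, b.integral_normed, one_mul]
    _ ≤ ∫ t, b.normed μ t * f (x - t) ∂μ := by
        refine integral_mono (b.integrable_normed.mul_const c)
          (integrable_normed_mul_comp_sub b hf x) fun t => ?_
        by_cases ht : t ∈ Metric.ball 0 b.rOut
        · exact mul_le_mul_of_nonneg_left (h _ (by simpa using ht)) (b.nonneg_normed t)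
        · rw [← b.support_normed_eq (μ := μ), Function.notMem_support] at ht
          simp only [ht, zero_mul, le_refl]

theorem normed_convolution_sub (hf : Continuous f) (x y : F) :
    (b.normed μ ⋆[lsmul ℝ ℝ, μ] f) y - (b.normed μ ⋆[lsmul ℝ ℝ, μ] f) x =
      (b.normed μ ⋆[lsmul ℝ ℝ, μ] fun z => f (y - x + z) - f z) x := by
  simp only [convolution_lsmul, smul_eq_mul]
  rw [← integral_sub (integrable_normed_mul_comp_sub b hf y)
    (integrable_normed_mul_comp_sub b hf x)]
  congr! 2 with t
  rw [mul_sub]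
  congr! 3
  abel

theorem norm_fderiv_normed_convolution_le (hf : Continuous f) {C r : ℝ} (hC : 0 ≤ C)
    (hr : b.rOut < r)
    (h : ∀ y ∈ Metric.ball x r, ∀ z ∈ Metric.ball x r, |f y - f z| ≤ C * ‖y - z‖) :
    ‖fderiv ℝ (b.normed μ ⋆[lsmul ℝ ℝ, μ] f) x‖ ≤ C := by
  refine norm_fderiv_le_of_lip' ℝ hC ?_
  filter_upwards [Metric.ball_mem_nhds x (sub_pos.2 hr)] with y hy
  rw [normed_convolution_sub b hf, ← dist_zero_right]
  refine dist_convolution_le (by positivity) b.support_normed_eq.subset b.nonneg_normed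
    b.integral_normed (by fun_prop) fun z hz => ?_
  have mem_ball : y - x + z ∈ Metric.ball x r := by
    rw [mem_ball_iff_norm] at hy hz ⊢
    calc ‖y - x + z - x‖ = ‖(y - x) + (z - x)‖ := by rw [add_sub_assoc]
      _ ≤ ‖y - x‖ + ‖z - x‖ := norm_add_le _ _
      _ < r := by linarith
  simpa using h _ mem_ball z (Metric.ball_subset_ball hr.le hz)

end Mollification

section StripProfile

variable {R q s t : ℝ}

/-- The torsion function of the slab `{0 < t < 2 * R}` at distance `t ≤ R` from its boundary, where
`q` is the exponent conjugate to `p`. -/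
noncomputable def stripProfile (R q t : ℝ) : ℝ := (R ^ q - (R - t) ^ q) / q

theorem stripProfile_zero : stripProfile R q 0 = 0 := by simp [stripProfile]

theorem continuous_stripProfile (hq : 0 ≤ q) : Continuous (stripProfile R q) := by
  have : Continuous fun t => (R - t) ^ q := by
    fun_prop (disch := exact fun _ => .inr hq)
  exact (continuous_const.sub this).div_const q

theorem hasDerivAt_stripProfile (hq : 1 ≤ q) (t : ℝ) :
    HasDerivAt (stripProfile R q) ((R - t) ^ (q - 1)) t := by
  have h := ((((hasDerivAt_id t).const_sub R).rpow_const (p := q) (.inr hq)).const_sub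
    (R ^ q)).div_const q
  refine h.congr_deriv ?_
  simp only [id_eq]
  field_simp

theorem stripProfile_le_stripProfile (hq : 0 < q) (hst : s ≤ t) (ht : t ≤ R) :
    stripProfile R q s ≤ stripProfile R q t := by
  unfold stripProfile
  gcongr

theorem abs_stripProfile_sub_le (hq : 1 ≤ q) {a : ℝ} (hs : s ∈ Set.Icc a R)
    (ht : t ∈ Set.Icc a R) :
    |stripProfile R q s - stripProfile R q t| ≤ (R - a) ^ (q - 1) * |s - t| := by
  refine (convex_Icc a R).norm_image_sub_le_of_norm_hasDerivWithin_le
    (fun u _ => (hasDerivAt_stripProfile hq u).hasDerivWithinAt) (fun u hu => ?_) ht hs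
  have : 0 ≤ R - u := sub_nonneg.2 hu.2
  rw [Real.norm_of_nonneg (by positivity)]
  gcongr
  exact hu.1

end StripProfile

section Mollified

open scoped Convolution
open ContinuousLinearMap (lsmul)

variable {D : ℕ} {R q ε : ℝ} {δ f : E D → ℝ} {x y : E D}

theorem abs_sub_lt_of_mem_ball (hδ : LipschitzWith 1 δ) {r : ℝ} (h : y ∈ Metric.ball x r) :
    |δ y - δ x| < r := by
  simpa [Real.dist_eq] using (hδ.dist_le_mul y x).trans_lt (by simpa using h)

theorem isTestFunction_normed_convolution (b : ContDiffBump (0 : E D)) (hf : Continuous f)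
    (hδ : LipschitzWith 1 δ) (hbdd : Bornology.IsBounded {x | 0 < δ x})
    (h : ∀ x, δ x < 2 * b.rOut → f x = 0) :
    IsTestFunction {x | 0 < δ x} (b.normed volume ⋆[lsmul ℝ ℝ, volume] f) := by
  have support_subset : Function.support (b.normed volume ⋆[lsmul ℝ ℝ, volume] f) ⊆
      {x | b.rOut ≤ δ x} := fun x hx => by
    contrapose! hx
    have hx : δ x < b.rOut := not_le.1 hx
    have f_eq_zero {y} (hy : y ∈ Metric.ball x b.rOut) : f y = 0 :=
      h y (by linarith [abs_lt.1 (abs_sub_lt_of_mem_ball hδ hy)])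
    have f_self := f_eq_zero (Metric.mem_ball_self b.rOut_pos)
    rw [Function.notMem_support, ← f_self]
    exact b.normed_convolution_eq_right fun y hy => by rw [f_eq_zero hy, f_self]
  have tsupport_subset : tsupport (b.normed volume ⋆[lsmul ℝ ℝ, volume] f) ⊆ {x | 0 < δ x} :=
    (closure_minimal support_subset (isClosed_le continuous_const hδ.continuous)).trans
      fun x hx => b.rOut_pos.trans_le hx
  exact ⟨b.hasCompactSupport_normed.contDiff_convolution_left _ b.contDiff_normed
    hf.locallyIntegrable, Metric.isCompact_of_isClosed_isBounded (isClosed_tsupport _)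
    (hbdd.subset tsupport_subset), tsupport_subset⟩

theorem exists_isTestFunction_stripProfile_le (hq : 1 ≤ q) (hδ : LipschitzWith 1 δ)
    (hR : 0 ≤ R) (hδR : ∀ x, δ x ≤ R) (hbdd : Bornology.IsBounded {x | 0 < δ x}) (hε : 0 < ε) :
    ∃ φ, IsTestFunction {x | 0 < δ x} φ ∧ ∀ x,
      stripProfile R q (max (δ x - 4 * ε) 0) ≤ φ x ∧
      ‖gradient φ x‖ ≤ (R - max (δ x - 4 * ε) 0) ^ (q - 1) := by
  have max_le_R (x : E D) : max (δ x - 2 * ε) 0 ≤ R := max_le (by linarith [hδR x]) hR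
  have f_cont : Continuous fun x => stripProfile R q (max (δ x - 2 * ε) 0) := by
    have := hδ.continuous
    exact (continuous_stripProfile (by linarith)).comp (by fun_prop)
  let b : ContDiffBump (0 : E D) := ⟨ε / 2, ε, by linarith, by linarith⟩
  have mem_Icc {x y} (hy : y ∈ Metric.ball x (2 * ε)) :
      max (δ y - 2 * ε) 0 ∈ Set.Icc (max (δ x - 4 * ε) 0) R :=
    ⟨max_le_max_right 0 (by linarith [abs_lt.1 (abs_sub_lt_of_mem_ball hδ hy)]), max_le_R y⟩
  refine ⟨_, isTestFunction_normed_convolution b f_cont hδ hbdd fun x (hx : δ x < 2 * ε) => ?_,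
    fun x => ⟨?_, ?_⟩⟩
  · rw [max_eq_right (by linarith), stripProfile_zero]
  · refine le_normed_convolution b f_cont fun y (hy : y ∈ Metric.ball x ε) => ?_
    have := mem_Icc (Metric.ball_subset_ball (by linarith) hy)
    exact stripProfile_le_stripProfile (by linarith) this.1 this.2
  · have : 0 ≤ R - max (δ x - 4 * ε) 0 := sub_nonneg.2 (max_le (by linarith [hδR x]) hR)
    rw [norm_gradient]
    refine norm_fderiv_normed_convolution_le b f_cont (r := 2 * ε) (by positivity)
      (show ε < 2 * ε by linarith) fun y hy z hz => ?_
    refine (abs_stripProfile_sub_le hq (mem_Icc hy) (mem_Icc hz)).trans ?_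
    gcongr
    calc |max (δ y - 2 * ε) 0 - max (δ z - 2 * ε) 0| ≤ |(δ y - 2 * ε) - (δ z - 2 * ε)| :=
          abs_max_sub_max_le_abs _ _ _
      _ ≤ ‖y - z‖ := by
          simpa [Real.dist_eq, dist_eq_norm] using hδ.dist_le_mul y z

end Mollified

section LowerBound

variable {D : ℕ} {p q R : ℝ} {δ u : E D → ℝ} {G : E D → E D}

theorem integrableOn_of_continuous_of_isBounded {Ω : Set (E D)} {f : E D → ℝ} (hf : Continuous f)
    (hΩ : Bornology.IsBounded Ω) : IntegrableOn f Ω :=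
  (hf.continuousOn.integrableOn_compact hΩ.isCompact_closure).mono_set subset_closure

theorem IsWeakSolution.setIntegral_stripProfile_max_le (h : IsWeakSolution p {x | 0 < δ x} u G)
    (hpq : p.HolderConjugate q) (hδ : LipschitzWith 1 δ) (hR : 0 ≤ R) (hδR : ∀ x, δ x ≤ R)
    (hbdd : Bornology.IsBounded {x | 0 < δ x}) {ε : ℝ} (hε : 0 < ε) :
    ∫ x in {x | 0 < δ x}, stripProfile R q (max (δ x - 4 * ε) 0) ≤
      (∫ x in {x | 0 < δ x}, u x) ^ (1 / q) *
        (∫ x in {x | 0 < δ x}, (R - max (δ x - 4 * ε) 0) ^ q) ^ (1 / p) := by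
  have hp := hpq.pos
  have hq := hpq.symm.pos
  have := hδ.continuous
  obtain ⟨φ, hφ, φ_bound⟩ :=
    exists_isTestFunction_stripProfile_le hpq.symm.lt.le hδ hR hδR hbdd hε
  have profile_integrable : IntegrableOn (fun x => stripProfile R q (max (δ x - 4 * ε) 0))
      {x | 0 < δ x} :=
    integrableOn_of_continuous_of_isBounded
      ((continuous_stripProfile hq.le).comp (by fun_prop)) hbdd
  have rpow_integrable : IntegrableOn (fun x => (R - max (δ x - 4 * ε) 0) ^ q) {x | 0 < δ x} :=
    integrableOn_of_continuous_of_isBounded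
      (Continuous.rpow_const (by fun_prop) fun _ => .inr hq.le) hbdd
  have gradient_le (x : E D) : ‖gradient φ x‖ ^ p ≤ (R - max (δ x - 4 * ε) 0) ^ q := by
    have : 0 ≤ R - max (δ x - 4 * ε) 0 := sub_nonneg.2 (max_le (by linarith [hδR x]) hR)
    rw [← hpq.symm.sub_one_mul_conj, Real.rpow_mul this]
    exact Real.rpow_le_rpow (norm_nonneg _) (φ_bound x).2 hp.le
  calc _ ≤ ∫ x in {x | 0 < δ x}, φ x :=
        integral_mono profile_integrable
          (integrableOn_of_continuous_of_isBounded hφ.1.continuous hbdd) fun x => (φ_bound x).1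
    _ ≤ (∫ x in {x | 0 < δ x}, u x) ^ (1 / q) *
          (∫ x in {x | 0 < δ x}, ‖gradient φ x‖ ^ p) ^ (1 / p) :=
        h.setIntegral_le hpq hφ.memWZero
    _ ≤ _ := by
        refine mul_le_mul_of_nonneg_left (Real.rpow_le_rpow (integral_nonneg fun x => by positivity)
          ?_ (by positivity)) (Real.rpow_nonneg (h.setIntegral_nonneg hpq.ne_zero) _)
        exact integral_mono_of_nonneg (.of_forall fun x => by positivity) rpow_integrable
          (.of_forall gradient_le)

theorem tendsto_setIntegral_comp_max_sub [IsFiniteMeasure (volume.restrict {x | 0 < δ x})]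
    (hδ : Continuous δ) (hR : 0 ≤ R) (hδR : ∀ x, δ x ≤ R) {g : ℝ → ℝ} (hg : Continuous g) :
    Tendsto (fun n : ℕ => ∫ x in {x | 0 < δ x}, g (max (δ x - 4 * (1 / ((n : ℝ) + 1))) 0)) atTop
      (𝓝 (∫ x in {x | 0 < δ x}, g (δ x))) := by
  obtain ⟨C, hC⟩ := isCompact_Icc (a := 0) (b := R) |>.exists_bound_of_continuousOn hg.continuousOn
  refine tendsto_integral_of_dominated_convergence (fun _ => C)
    (fun n => (hg.comp (by fun_prop)).aestronglyMeasurable) (integrable_const C)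
    (fun n => .of_forall fun x => hC _ ⟨le_max_right _ _, max_le ?_ hR⟩) ?_
  · have : (0 : ℝ) ≤ 1 / (n + 1) := by positivity
    linarith [hδR x]
  · filter_upwards [ae_restrict_mem (isOpen_lt continuous_const hδ).measurableSet] with x hx
    have h := ((tendsto_one_div_add_atTop_nhds_zero_nat (𝕜 := ℝ)).const_mul 4).const_sub (δ x)
    rw [mul_zero, sub_zero] at h
    refine (hg.tendsto _).comp ?_
    simpa only [max_eq_left (le_of_lt hx)] using h.max (tendsto_const_nhds (x := (0 : ℝ)))

theorem IsWeakSolution.setIntegral_stripProfile_le (h : IsWeakSolution p {x | 0 < δ x} u G)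
    (hpq : p.HolderConjugate q) (hδ : LipschitzWith 1 δ) (hR : 0 ≤ R) (hδR : ∀ x, δ x ≤ R)
    (hbdd : Bornology.IsBounded {x | 0 < δ x}) :
    ∫ x in {x | 0 < δ x}, stripProfile R q (δ x) ≤
      (∫ x in {x | 0 < δ x}, u x) ^ (1 / q) *
        (∫ x in {x | 0 < δ x}, (R - δ x) ^ q) ^ (1 / p) := by
  have : IsFiniteMeasure (volume.restrict {x | 0 < δ x}) :=
    isFiniteMeasure_restrict.2 hbdd.measure_lt_top.ne
  have hp := hpq.pos
  have hq := hpq.symm.pos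
  have rpow_cont : Continuous fun t => (R - t) ^ q :=
    Continuous.rpow_const (by fun_prop) fun _ => .inr hq.le
  exact le_of_tendsto_of_tendsto'
    (tendsto_setIntegral_comp_max_sub hδ.continuous hR hδR (continuous_stripProfile hq.le))
    (((tendsto_setIntegral_comp_max_sub hδ.continuous hR hδR rpow_cont).rpow_const
      (.inr (by positivity))).const_mul _)
    fun n => h.setIntegral_stripProfile_max_le hpq hδ hR hδR hbdd (by positivity)

end LowerBound

/-! ### Layer-cake formulas -/

section LayerCake

variable {α : Type*} [MeasurableSpace α] {μ : Measure α} [IsFiniteMeasure μ] {f : α → ℝ}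
  {q R : ℝ}

theorem integral_intervalIntegral_eq (hf : AEMeasurable f μ) (hf0 : 0 ≤ᵐ[μ] f) (hR : 0 ≤ R)
    (hfR : ∀ᵐ x ∂μ, f x ≤ R) {g : ℝ → ℝ} (hg : Continuous g) (hg0 : ∀ t, 0 ≤ g t) :
    ∫ x, (∫ t in 0..f x, g t) ∂μ = ∫ t in 0..R, μ.real {x | t < f x} * g t := by
  have antitone_measure : Antitone fun t => μ.real {x | t < f x} := fun s t hst =>
    measureReal_mono fun x (hx : t < f x) => hst.trans_lt hx
  have measure_eq_zero {t : ℝ} (ht : R ≤ t) : μ.real {x | t < f x} = 0 := by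
    refine (measureReal_eq_zero_iff).2 (measure_mono_null (fun x hx => ?_) hfR)
    exact not_le.2 (ht.trans_lt hx)
  have integral_nonneg : 0 ≤ᵐ[μ] fun x => ∫ t in 0..f x, g t := by
    filter_upwards [hf0] with x hx
    exact intervalIntegral.integral_nonneg hx fun t _ => hg0 t
  have integral_meas : AEStronglyMeasurable (fun x => ∫ t in 0..f x, g t) μ :=
    ((intervalIntegral.continuous_primitive (fun a b => hg.intervalIntegrable a b)
      0).measurable.comp_aemeasurable hf).aestronglyMeasurable
  rw [intervalIntegral.integral_of_le hR,
    ← setIntegral_eq_of_subset_of_forall_sdiff_eq_zero measurableSet_Ioi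
      Set.Ioc_subset_Ioi_self fun t ht => by
        rw [measure_eq_zero (not_le.1 fun h => ht.2 ⟨ht.1, h⟩).le, zero_mul],
    integral_eq_lintegral_of_nonneg_ae integral_nonneg integral_meas,
    lintegral_comp_eq_lintegral_meas_lt_mul μ hf0 hf (fun t _ => hg.intervalIntegrable 0 t)
      (.of_forall hg0),
    integral_eq_lintegral_of_nonneg_ae (.of_forall fun t => mul_nonneg measureReal_nonneg (hg0 t))
      (antitone_measure.measurable.mul hg.measurable).aestronglyMeasurable]
  congr! 3
  rw [ENNReal.ofReal_mul measureReal_nonneg, ofReal_measureReal]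

theorem intervalIntegral_abs_sub_rpow (hq : 1 ≤ q) {t : ℝ} (ht0 : 0 ≤ t) (ht : t ≤ R) :
    ∫ s in 0..t, |R - s| ^ (q - 1) = stripProfile R q t := by
  have abs_cont : Continuous fun s => |R - s| ^ (q - 1) :=
    Continuous.rpow_const (by fun_prop) fun _ => .inr (by linarith)
  suffices ∫ s in 0..t, |R - s| ^ (q - 1) = stripProfile R q t - stripProfile R q 0 by
    rwa [stripProfile_zero, sub_zero] at this
  refine intervalIntegral.integral_eq_sub_of_hasDerivAt (fun s hs => ?_)
    (abs_cont.intervalIntegrable _ _)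
  rw [Set.uIcc_of_le ht0] at hs
  rw [abs_of_nonneg (by linarith [hs.2])]
  exact hasDerivAt_stripProfile hq s

theorem integral_stripProfile_comp (hq : 1 ≤ q) (hf : AEMeasurable f μ) (hf0 : 0 ≤ᵐ[μ] f)
    (hR : 0 ≤ R) (hfR : ∀ᵐ x ∂μ, f x ≤ R) :
    ∫ x, stripProfile R q (f x) ∂μ =
      ∫ t in 0..R, μ.real {x | t < f x} * (R - t) ^ (q - 1) := by
  have abs_cont : Continuous fun t => |R - t| ^ (q - 1) :=
    Continuous.rpow_const (by fun_prop) fun _ => .inr (by linarith)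
  calc ∫ x, stripProfile R q (f x) ∂μ = ∫ x, (∫ t in 0..f x, |R - t| ^ (q - 1)) ∂μ := by
        refine integral_congr_ae ?_
        filter_upwards [hf0, hfR] with x hx0 hxR
        exact (intervalIntegral_abs_sub_rpow hq hx0 hxR).symm
    _ = ∫ t in 0..R, μ.real {x | t < f x} * |R - t| ^ (q - 1) :=
        integral_intervalIntegral_eq hf hf0 hR hfR abs_cont fun t => by positivity
    _ = ∫ t in 0..R, μ.real {x | t < f x} * (R - t) ^ (q - 1) := by
        refine intervalIntegral.integral_congr fun t ht => ?_
        rw [Set.uIcc_of_le hR] at ht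
        simp only [abs_of_nonneg (sub_nonneg.2 ht.2)]

theorem integral_sub_rpow (hq : 0 < q) (hf : AEMeasurable f μ) (hf0 : 0 ≤ᵐ[μ] f)
    (hfR : ∀ᵐ x ∂μ, f x ≤ R) :
    ∫ x, (R - f x) ^ q ∂μ = μ.real Set.univ * R ^ q - q * ∫ x, stripProfile R q (f x) ∂μ := by
  have cont := continuous_stripProfile (R := R) hq.le
  obtain ⟨C, hC⟩ :=
    isCompact_Icc (a := 0) (b := R) |>.exists_bound_of_continuousOn cont.continuousOn
  have integrable : Integrable (fun x => stripProfile R q (f x)) μ := by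
    refine .of_bound (cont.measurable.comp_aemeasurable hf).aestronglyMeasurable C ?_
    filter_upwards [hf0, hfR] with x hx0 hxR using hC _ ⟨hx0, hxR⟩
  calc ∫ x, (R - f x) ^ q ∂μ = ∫ x, (R ^ q - q * stripProfile R q (f x)) ∂μ := by
        congr! 2 with x
        rw [stripProfile]
        field_simp
        ring
    _ = _ := by
        rw [integral_sub (integrable_const _) (integrable.const_mul q), integral_const,
          integral_const_mul, smul_eq_mul]

end LayerCake

/-! ### Rectangles -/

section Rectangle

variable {R L q : ℝ}

theorem volume_real_box {a b c d : ℝ} (hab : a ≤ b) (hcd : c ≤ d) :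
    volume.real {x : E 2 | x 0 ∈ Set.Ioo a b ∧ x 1 ∈ Set.Ioo c d} = (b - a) * (d - c) := by
  have box_eq : {x : E 2 | x 0 ∈ Set.Ioo a b ∧ x 1 ∈ Set.Ioo c d} =
      WithLp.ofLp ⁻¹' Set.univ.pi fun i => Set.Ioo (![a, c] i) (![b, d] i) := by
    ext x
    simp
  rw [box_eq, measureReal_def, (PiLp.volume_preserving_ofLp (Fin 2)).measure_preimage
    (MeasurableSet.univ_pi fun i => measurableSet_Ioo).nullMeasurableSet,
    Real.volume_pi_Ioo_toReal (fun i => by fin_cases i <;> simpa), Fin.prod_univ_two]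
  simp

theorem measureReal_rectangle (hR : 0 ≤ R) (hL : 0 ≤ L) :
    volume.real (rectangle R L) = 2 * L * R := by
  rw [rectangle, volume_real_box hL (by positivity)]
  ring

/-- The depth of a point in the rectangle `(0,L) × (0,2R)`: the distance to the boundary for points
inside, and a nonpositive number for points outside. -/
noncomputable def rectangleDepth (R L : ℝ) (x : E 2) : ℝ :=
  min (min (x 0) (L - x 0)) (min (x 1) (2 * R - x 1))

theorem lipschitzWith_coord {D : ℕ} (i : Fin D) : LipschitzWith 1 fun x : E D => x i :=
  LipschitzWith.of_dist_le_mul fun x y => by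
    rw [NNReal.coe_one, one_mul, dist_eq_norm, dist_eq_norm]
    exact PiLp.norm_apply_le (x - y) i

theorem lipschitzWith_rectangleDepth (R L : ℝ) : LipschitzWith 1 (rectangleDepth R L) := by
  have const_sub_coord (i : Fin 2) (c : ℝ) : LipschitzWith 1 fun x : E 2 => c - x i := by
    simpa using (LipschitzWith.const c).sub (lipschitzWith_coord i)
  have min_min := ((lipschitzWith_coord 0).min (const_sub_coord 0 L)).min
    ((lipschitzWith_coord 1).min (const_sub_coord 1 (2 * R)))
  rw [max_self, max_self] at min_min
  exact min_min

theorem lt_rectangleDepth_iff {x : E 2} {t : ℝ} :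
    t < rectangleDepth R L x ↔ x 0 ∈ Set.Ioo t (L - t) ∧ x 1 ∈ Set.Ioo t (2 * R - t) := by
  simp only [rectangleDepth, lt_min_iff, Set.mem_Ioo, lt_sub_comm]

theorem setOf_rectangleDepth_pos (R L : ℝ) : {x | 0 < rectangleDepth R L x} = rectangle R L := by
  ext x
  simp [lt_rectangleDepth_iff, rectangle]

theorem measurableSet_rectangle (R L : ℝ) : MeasurableSet (rectangle R L) := by
  rw [← setOf_rectangleDepth_pos]
  exact (isOpen_lt continuous_const (lipschitzWith_rectangleDepth R L).continuous).measurableSet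

theorem rectangleDepth_le (R L : ℝ) (x : E 2) : rectangleDepth R L x ≤ R := by
  have h1 : rectangleDepth R L x ≤ x 1 := (min_le_right _ _).trans (min_le_left _ _)
  have h2 : rectangleDepth R L x ≤ 2 * R - x 1 := (min_le_right _ _).trans (min_le_right _ _)
  linarith

theorem isBounded_rectangle (R L : ℝ) : Bornology.IsBounded (rectangle R L) := by
  refine (Metric.isBounded_closedBall (x := (0 : E 2)) (r := L + 2 * R)).subset fun x hx => ?_
  obtain ⟨⟨h1, h2⟩, h3, h4⟩ := hx
  rw [mem_closedBall_zero_iff, EuclideanSpace.norm_eq, Fin.sum_univ_two]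
  refine Real.sqrt_le_iff.2 ⟨by linarith, ?_⟩
  rw [Real.norm_of_nonneg h1.le, Real.norm_of_nonneg h3.le]
  nlinarith

instance isFiniteMeasure_restrict_rectangle :
    IsFiniteMeasure (volume.restrict (rectangle R L)) :=
  isFiniteMeasure_restrict.2 (isBounded_rectangle R L).measure_lt_top.ne

theorem measureReal_restrict_lt_rectangleDepth {t : ℝ} (ht0 : 0 ≤ t) (htR : t ≤ R)
    (hL : 2 * R ≤ L) :
    (volume.restrict (rectangle R L)).real {x | t < rectangleDepth R L x} =
      2 * (L - 2 * R) * (R - t) + 4 * (R - t) ^ 2 := by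
  have inter_eq : {x | t < rectangleDepth R L x} ∩ rectangle R L =
      {x | x 0 ∈ Set.Ioo t (L - t) ∧ x 1 ∈ Set.Ioo t (2 * R - t)} := by
    rw [← setOf_rectangleDepth_pos]
    ext x
    simp only [Set.mem_inter_iff, Set.mem_ofPred_eq, ← lt_rectangleDepth_iff, and_iff_left_iff_imp]
    exact ht0.trans_lt
  rw [measureReal_restrict_apply' (measurableSet_rectangle R L), inter_eq,
    volume_real_box (by linarith) (by linarith)]
  ring

theorem measureReal_restrict_lt_sub_abs {t : ℝ} (ht0 : 0 ≤ t) (htR : t ≤ R) (hL : 0 ≤ L) :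
    (volume.restrict (rectangle R L)).real {x | t < R - |x 1 - R|} = 2 * L * (R - t) := by
  have inter_eq : {x | t < R - |x 1 - R|} ∩ rectangle R L =
      {x | x 0 ∈ Set.Ioo 0 L ∧ x 1 ∈ Set.Ioo t (2 * R - t)} := by
    ext x
    simp only [Set.mem_inter_iff, Set.mem_ofPred_eq, rectangle, Set.mem_Ioo, lt_sub_comm (a := t),
      abs_lt]
    constructor
    · rintro ⟨⟨h1, h2⟩, h, -⟩
      exact ⟨h, by linarith, by linarith⟩
    · rintro ⟨h, h1, h2⟩
      exact ⟨⟨by linarith, by linarith⟩, h, by linarith, by linarith⟩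
  rw [measureReal_restrict_apply' (measurableSet_rectangle R L), inter_eq,
    volume_real_box hL (by linarith)]
  ring

theorem integral_add_sq_mul_sub_rpow (hR : 0 < R) (hq : 0 < q) (a b : ℝ) :
    ∫ t in 0..R, (a * (R - t) + b * (R - t) ^ 2) * (R - t) ^ (q - 1) =
      a * R ^ (q + 1) / (q + 1) + b * R ^ (q + 2) / (q + 2) := by
  rw [intervalIntegral.integral_comp_sub_left (fun s => (a * s + b * s ^ 2) * s ^ (q - 1)),
    sub_self, sub_zero]
  have integrand_eq : ∀ s ∈ Set.uIoc 0 R,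
      (a * s + b * s ^ 2) * s ^ (q - 1) = a * s ^ q + b * s ^ (q + 1) := fun s hs => by
    rw [Set.uIoc_of_le hR.le] at hs
    rw [Real.rpow_add_one hs.1.ne', Real.rpow_sub_one hs.1.ne']
    field_simp [hs.1.ne']
  rw [intervalIntegral.integral_congr_ae (.of_forall integrand_eq),
    intervalIntegral.integral_add, intervalIntegral.integral_const_mul,
    intervalIntegral.integral_const_mul, integral_rpow (.inl (by linarith)),
    integral_rpow (.inl (by linarith)), Real.zero_rpow (by positivity),
    Real.zero_rpow (by positivity)]
  · rw [sub_zero, sub_zero, add_assoc q 1 1, one_add_one_eq_two, mul_div_assoc, mul_div_assoc]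
  · exact (intervalIntegral.intervalIntegrable_rpow' (by linarith)).const_mul a
  · exact (intervalIntegral.intervalIntegrable_rpow' (by linarith)).const_mul b

theorem ae_restrict_rectangleDepth_nonneg :
    ∀ᵐ x ∂volume.restrict (rectangle R L), 0 ≤ rectangleDepth R L x := by
  filter_upwards [ae_restrict_mem (measurableSet_rectangle R L)] with x hx
  rw [← setOf_rectangleDepth_pos] at hx
  exact le_of_lt hx

theorem setIntegral_stripProfile_rectangleDepth (hR : 0 < R) (hL : 2 * R ≤ L) (hq : 1 ≤ q) :
    ∫ x in rectangle R L, stripProfile R q (rectangleDepth R L x) =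
      2 * (L - 2 * R) * R ^ (q + 1) / (q + 1) + 4 * R ^ (q + 2) / (q + 2) := by
  rw [integral_stripProfile_comp hq (lipschitzWith_rectangleDepth R L).continuous.aemeasurable
    ae_restrict_rectangleDepth_nonneg hR.le (.of_forall (rectangleDepth_le R L)),
    ← integral_add_sq_mul_sub_rpow hR (by linarith)]
  refine intervalIntegral.integral_congr fun t ht => ?_
  rw [Set.uIcc_of_le hR.le] at ht
  simp only [measureReal_restrict_lt_rectangleDepth ht.1 ht.2 hL]

theorem setIntegral_sub_rectangleDepth_rpow (hR : 0 < R) (hL : 2 * R ≤ L) (hq : 1 ≤ q) :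
    ∫ x in rectangle R L, (R - rectangleDepth R L x) ^ q =
      2 * (L - 2 * R) * R ^ (q + 1) / (q + 1) + 8 * R ^ (q + 2) / (q + 2) := by
  rw [integral_sub_rpow (by linarith) (lipschitzWith_rectangleDepth R L).continuous.aemeasurable
    ae_restrict_rectangleDepth_nonneg (.of_forall (rectangleDepth_le R L)),
    setIntegral_stripProfile_rectangleDepth hR hL hq, measureReal_restrict_apply_univ,
    measureReal_rectangle hR.le (by linarith), Real.rpow_add hR q 2, Real.rpow_two,
    Real.rpow_add_one hR.ne']
  field_simp
  ring

theorem abs_sub_le_of_mem_rectangle {x : E 2} (hx : x ∈ rectangle R L) : |x 1 - R| ≤ R :=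
  abs_le.2 ⟨by linarith [hx.2.1], by linarith [hx.2.2]⟩

theorem setIntegral_abs_sub_rpow (hR : 0 < R) (hL : 0 ≤ L) (hq : 1 ≤ q) :
    ∫ x in rectangle R L, |x 1 - R| ^ q = 2 * L * R ^ (q + 1) / (q + 1) := by
  have depth_aemeasurable :
      AEMeasurable (fun x : E 2 => R - |x 1 - R|) (volume.restrict (rectangle R L)) :=
    Continuous.aemeasurable (by fun_prop)
  have depth_nonneg : ∀ᵐ x ∂volume.restrict (rectangle R L), 0 ≤ R - |x 1 - R| := by
    filter_upwards [ae_restrict_mem (measurableSet_rectangle R L)] with x hx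
    exact sub_nonneg.2 (abs_sub_le_of_mem_rectangle hx)
  have depth_le : ∀ᵐ x ∂volume.restrict (rectangle R L), R - |x 1 - R| ≤ R :=
    .of_forall fun x => sub_le_self _ (abs_nonneg _)
  have profile_integral : ∫ x in rectangle R L, stripProfile R q (R - |x 1 - R|) =
      2 * L * R ^ (q + 1) / (q + 1) := by
    have := integral_add_sq_mul_sub_rpow hR (show 0 < q by linarith) (2 * L) 0
    rw [zero_mul, zero_div, add_zero] at this
    rw [integral_stripProfile_comp hq depth_aemeasurable depth_nonneg hR.le depth_le, ← this]
    refine intervalIntegral.integral_congr fun t ht => ?_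
    rw [Set.uIcc_of_le hR.le] at ht
    simp only [measureReal_restrict_lt_sub_abs ht.1 ht.2 hL, zero_mul, add_zero]
  have identity :=
    integral_sub_rpow (show 0 < q by linarith) depth_aemeasurable depth_nonneg depth_le
  simp only [sub_sub_cancel] at identity
  rw [identity, profile_integral, measureReal_restrict_apply_univ,
    measureReal_rectangle hR.le hL, Real.rpow_add_one hR.ne']
  field_simp
  ring

end Rectangle

section Competitors

variable {R L p q : ℝ}

theorem lt_add_eight_mul_rpow_add_two (hR : 0 < R) (hq : 0 < q) :
    2 * L * R ^ (q + 1) / (q + 1) <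
      2 * (L - 2 * R) * R ^ (q + 1) / (q + 1) + 8 * R ^ (q + 2) / (q + 2) := by
  have diff_eq : 2 * (L - 2 * R) * R ^ (q + 1) / (q + 1) + 8 * R ^ (q + 2) / (q + 2) -
      2 * L * R ^ (q + 1) / (q + 1) = 4 * q * (R ^ q * R ^ 2) / ((q + 1) * (q + 2)) := by
    rw [Real.rpow_add hR q 2, Real.rpow_two, Real.rpow_add_one hR.ne']
    field_simp
    ring
  exact sub_pos.1 (diff_eq ▸ by positivity)

theorem add_eight_mul_rpow_add_two_le (hR : 0 < R) (hL : 2 * R ≤ L) (hq : 0 < q) :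
    2 * (L - 2 * R) * R ^ (q + 1) / (q + 1) + 8 * R ^ (q + 2) / (q + 2) ≤
      (1 + 2 * R / L) *
        (2 * (L - 2 * R) * R ^ (q + 1) / (q + 1) + 4 * R ^ (q + 2) / (q + 2)) := by
  have L_pos : 0 < L := by linarith
  have := sub_nonneg.2 hL
  have diff_eq : (1 + 2 * R / L) *
        (2 * (L - 2 * R) * R ^ (q + 1) / (q + 1) + 4 * R ^ (q + 2) / (q + 2)) -
      (2 * (L - 2 * R) * R ^ (q + 1) / (q + 1) + 8 * R ^ (q + 2) / (q + 2)) =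
        4 * (L - 2 * R) * (R ^ q * R ^ 2) / (L * (q + 1) * (q + 2)) := by
    rw [Real.rpow_add hR q 2, Real.rpow_two, Real.rpow_add_one hR.ne']
    field_simp
    ring
  exact sub_nonneg.1 (diff_eq ▸ by positivity)

theorem exists_isWeakSolution_torsionFunction_rectangle (hpq : p.HolderConjugate q)
    (hR : 0 ≤ R) :
    ∃ G, IsWeakSolution p (rectangle R L) (torsionFunction p (rectangle R L)) G :=
  exists_isWeakSolution_torsionFunction
    (exists_isWeakSolution hpq hR fun _ => abs_sub_le_of_mem_rectangle)

theorem torsionalRigidity_rectangle_le (hpq : p.HolderConjugate q) (hR : 0 < R) (hL : 0 ≤ L) :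
    torsionalRigidity p (rectangle R L) ≤ 2 * L * R ^ (q + 1) / (q + 1) := by
  obtain ⟨G, hG⟩ := exists_isWeakSolution_torsionFunction_rectangle hpq (L := L) hR.le
  rw [← setIntegral_abs_sub_rpow hR hL hpq.symm.lt.le]
  exact hG.setIntegral_le_setIntegral_abs_coord_rpow hpq
    ((ae_restrict_mem (measurableSet_rectangle R L)).mono fun _ => abs_sub_le_of_mem_rectangle)

theorem torsionalRigidity_rectangle_nonneg (hpq : p.HolderConjugate q) (hR : 0 ≤ R) :
    0 ≤ torsionalRigidity p (rectangle R L) := by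
  obtain ⟨G, hG⟩ := exists_isWeakSolution_torsionFunction_rectangle hpq (L := L) hR
  exact hG.setIntegral_nonneg hpq.ne_zero

theorem lt_rpow_mul_torsionalRigidity_rectangle (hpq : p.HolderConjugate q) (hR : 0 < R)
    (hL : 2 * R ≤ L) :
    2 * L * R ^ (q + 1) / (q + 1) <
      (1 + 2 * R / L) ^ q * torsionalRigidity p (rectangle R L) := by
  obtain ⟨G, hG⟩ := exists_isWeakSolution_torsionFunction_rectangle hpq (L := L) hR.le
  have L_pos : 0 < L := by linarith
  have q_pos := hpq.symm.pos
  have profile_le : ∫ x in rectangle R L, stripProfile R q (rectangleDepth R L x) ≤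
      torsionalRigidity p (rectangle R L) ^ (1 / q) *
        (∫ x in rectangle R L, (R - rectangleDepth R L x) ^ q) ^ (1 / p) := by
    rw [← setOf_rectangleDepth_pos] at hG
    have := hG.setIntegral_stripProfile_le hpq (lipschitzWith_rectangleDepth R L) hR.le
      (rectangleDepth_le R L) (setOf_rectangleDepth_pos R L ▸ isBounded_rectangle R L)
    rwa [setOf_rectangleDepth_pos] at this
  rw [setIntegral_stripProfile_rectangleDepth hR hL hpq.symm.lt.le,
    setIntegral_sub_rectangleDepth_rpow hR hL hpq.symm.lt.le] at profile_le
  refine (lt_add_eight_mul_rpow_add_two hR q_pos).trans_le ?_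
  refine le_rpow_mul_of_le_mul_rpow_mul_rpow hpq.symm ?_
    (torsionalRigidity_rectangle_nonneg hpq hR.le) (by positivity) ?_
  · have := sub_nonneg.2 hL
    positivity
  · refine (add_eight_mul_rpow_add_two_le hR hL q_pos).trans ?_
    rw [mul_comm (_ ^ (1 / p))]
    gcongr

end Competitors

section Inradius

theorem inradius_rectangle {R L : ℝ} (hR : 0 ≤ R) (hL : 2 * R ≤ L) :
    inradius (rectangle R L) = R := by
  refine IsGreatest.csSup_eq ⟨⟨hR, !₂[L / 2, R], fun y hy => ?_⟩, ?_⟩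
  · have coord_lt (i : Fin 2) : |y i - (!₂[L / 2, R] : E 2) i| < R :=
      (PiLp.norm_apply_le (y - !₂[L / 2, R]) i).trans_lt (mem_ball_iff_norm.1 hy)
    have h0 := abs_lt.1 (coord_lt 0)
    have h1 := abs_lt.1 (coord_lt 1)
    simp only [Matrix.cons_val_zero, Matrix.cons_val_one] at h0 h1
    exact ⟨⟨by linarith, by linarith⟩, by linarith, by linarith⟩
  · rintro r ⟨-, x, hx⟩
    by_contra! hr
    have mem_rectangle {t : ℝ} (ht : |t| < r) : x + EuclideanSpace.single 1 t ∈ rectangle R L :=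
      hx <| by rwa [mem_ball_iff_norm, add_sub_cancel_left, PiLp.norm_single, Real.norm_eq_abs]
    obtain ⟨s, hRs, hsr⟩ := exists_between hr
    have abs_lt_r : |s| < r := by rwa [abs_of_pos (hR.trans_lt hRs)]
    have upper := (mem_rectangle abs_lt_r).2.2
    have lower := (mem_rectangle (abs_neg s ▸ abs_lt_r)).2.1
    simp only [PiLp.add_apply, PiLp.single_apply, if_true] at upper lower
    linarith

end Inradius

section Q

variable {D : ℕ} {p q : ℝ}

theorem Q_eq_rpow (hpq : p.HolderConjugate q) {Ω : Set (E D)} (hΩ : 0 ≤ torsionalRigidity p Ω)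
    (hρ : 0 ≤ inradius Ω) :
    Q p Ω = (volume.real Ω * inradius Ω ^ q / (q + 1) / torsionalRigidity p Ω) ^ (1 / q) := by
  have q_nonneg := hpq.symm.nonneg
  have sub_one_pos := hpq.sub_one_pos
  have const_eq : (2 * p - 1) / (p - 1) = q + 1 := by
    rw [hpq.conjugate_eq]
    field_simp
    ring
  have inradius_eq : inradius Ω ^ p = (inradius Ω ^ q) ^ (p - 1) := by
    rw [← Real.rpow_mul hρ, mul_comm, hpq.sub_one_mul_conj]
  have exponent_eq : 1 / q = (p - 1) * (1 / p) := by
    have := hpq.ne_zero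
    rw [one_div q, ← hpq.one_sub_inv]
    field_simp
  rw [Q, normalizedRigidity, ← measureReal_def, const_eq, inradius_eq, ← neg_sub p 1,
    Real.rpow_neg hΩ, exponent_eq, Real.rpow_mul (by positivity)]
  congr 1
  rw [Real.div_rpow (by positivity) hΩ, Real.div_rpow (by positivity) (by positivity),
    Real.mul_rpow (by positivity) (by positivity)]
  field_simp

theorem Q_rectangle_bounds (hp : 1 < p) {R L : ℝ} (hR : 0 < R) (hL : 2 * R ≤ L) :
    1 ≤ Q p (rectangle R L) ∧ Q p (rectangle R L) < 1 + 2 * R / L := by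
  have hpq := Real.HolderConjugate.conjExponent hp
  set q := p.conjExponent
  have q_pos := hpq.symm.pos
  have L_pos : 0 < L := by linarith
  have upper := torsionalRigidity_rectangle_le hpq hR L_pos.le
  have lower := lt_rpow_mul_torsionalRigidity_rectangle hpq hR hL
  have rigidity_pos : 0 < torsionalRigidity p (rectangle R L) :=
    pos_of_mul_pos_right (lt_trans (by positivity) lower) (by positivity)
  have inradius_eq := inradius_rectangle hR.le hL
  rw [Q_eq_rpow hpq rigidity_pos.le (inradius_eq.symm ▸ hR.le), inradius_eq,
    measureReal_rectangle hR.le L_pos.le,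
    show 2 * L * R * R ^ q = 2 * L * R ^ (q + 1) by rw [Real.rpow_add_one hR.ne']; ring]
  refine ⟨Real.one_le_rpow ((one_le_div rigidity_pos).2 upper) (by positivity), ?_⟩
  rwa [one_div, Real.rpow_inv_lt_iff_of_pos (by positivity) (by positivity) q_pos,
    div_lt_iff₀ rigidity_pos]

theorem Q_bounds_of_mem_rectangleFamily {κ : ℝ} (hp : 1 < p) (hκ : 2 ≤ κ) {Ω : Set (E 2)}
    (hΩ : Ω ∈ rectangleFamily κ) : 1 ≤ Q p Ω ∧ Q p Ω < 1 + 2 / κ := by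
  obtain ⟨R, L, hR, hL, hκL, rfl⟩ := hΩ
  rw [le_div_iff₀ hR] at hκL
  obtain ⟨lower, upper⟩ := Q_rectangle_bounds hp hR ((by gcongr : 2 * R ≤ κ * R).trans hκL)
  refine ⟨lower, upper.trans_le (add_le_add_right ?_ 1)⟩
  rw [div_le_div_iff₀ hL (by linarith)]
  linarith

theorem rectangleFamily_nonempty {κ : ℝ} (hκ : 0 < κ) : (rectangleFamily κ).Nonempty :=
  ⟨rectangle 1 κ, 1, κ, one_pos, hκ, (div_one κ).ge, rfl⟩

theorem div_le_familyRatio {F : Set (Set (E D))} (hF : F.Nonempty) {a b : ℝ} (ha : 0 < a)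
    (hab : ∀ Ω ∈ F, a ≤ Q p Ω ∧ Q p Ω ≤ b) : a / b ≤ familyRatio F p := by
  have le_inf : a ≤ familyInf F p :=
    le_csInf (hF.image _) (Set.forall_mem_image.2 fun Ω hΩ => (hab Ω hΩ).1)
  have sup_le : familySup F p ≤ b :=
    csSup_le (hF.image _) (Set.forall_mem_image.2 fun Ω hΩ => (hab Ω hΩ).2)
  obtain ⟨Ω, hΩ⟩ := hF
  have le_sup : Q p Ω ≤ familySup F p :=
    le_csSup ⟨b, Set.forall_mem_image.2 fun Ω hΩ => (hab Ω hΩ).2⟩ (Set.mem_image_of_mem _ hΩ)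
  have sup_pos : 0 < familySup F p := ha.trans_le ((hab Ω hΩ).1.trans le_sup)
  exact div_le_div₀ (ha.le.trans le_inf) le_inf sup_pos sup_le

end Q

end PTorsion

theorem mainTheorem8 (p κ : ℝ) (hp : 1 < p) (hκ : 2 ≤ κ) :
    (∀ Ω ∈ PTorsion.rectangleFamily κ, 1 ≤ PTorsion.Q p Ω ∧ PTorsion.Q p Ω < 1 + 2 / κ) ∧
    κ / (κ + 2) ≤ PTorsion.familyRatio (PTorsion.rectangleFamily κ) p := by
  have Q_bounds := fun Ω hΩ => PTorsion.Q_bounds_of_mem_rectangleFamily hp hκ (Ω := Ω) hΩ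
  refine ⟨Q_bounds, ?_⟩
  have ratio_eq : κ / (κ + 2) = 1 / (1 + 2 / κ) := by field_simp
  rw [ratio_eq]
  exact PTorsion.div_le_familyRatio (PTorsion.rectangleFamily_nonempty (by positivity)) one_pos
    fun Ω hΩ => (Q_bounds Ω hΩ).imp_right le_of_lt
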